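/- Let $\mathcal A$ be a category with an initial object $\varnothing$. **Fibrations.** Let $\mathbf{Fib}(\mathcal A)$ be the 2-category whose objects are the Grothendieck fibrations $p:\mathcal E\to\mathcal A$, whose 1-cells are the fibred functors over $\mathcal A$ (functors commuting strictly with the projections and preserving cartesian morphisms), and whose 2-cells are the vertical natural transformations. For a fibration $p:\mathcal E\to\mathcal A$ let $i:\mathcal E_\varnothing\to\mathcal E$ be the inclusion of the fibre over $\varnothing$, and $i_R$ its right adjoint (which exists: $i_RE$ is the domain of a cartesian lift of $\varnothing\to pE$). The fibration $p$ is *pruned* if it has a full and faithful left adjoint $p_L$, the coproduct $p_LA+iE_0$ exists for all $A\in\mathcal A$ and $E_0\in\mathcal E_\varnothing$, and $p$ preserves these coproducts. Let $\mathbf{PFib}(\mathcal A)\subseteq\mathbf{Fib}(\mathcal A)$ be the full sub-2-category of pruned fibrations. **Parametrized monads.** A parametrized monad over $\mathcal A$ is a category $\mathcal X$ with a functor $T$, $A\mapsto T_A$, from $\mathcal A$ to the category of monads on $\mathcal X$ and monad morphisms. A 1-cell $(\mathcal X,T)\to(\mathcal Y,S)$ is a functor $V:\mathcal X\to\mathcal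 Y$ with maps $\delta_{A,X}:S_AVX\to VT_AX$, natural in $A$ and $X$ and compatible with units and multiplications; a 2-cell $(V,\delta)\Rightarrow(V',\delta')$ is a natural transformation $\nu:V\Rightarrow V'$ with $\delta'\circ S_A\nu=\nu T_A\circ\delta$ for all $A$. The parametrized monad is *pruned* if $\mathcal X$ has an initial object and $T_\varnothing$ is isomorphic to the identity monad; let $\mathbf{PMnd}(\mathcal A)$ be the full sub-2-category of pruned ones. The *Eilenberg–Moore fibration* $p^T$ of $T$ has as total category the triples $(A,X,\xi)$ with $(X,\xi)$ a $T_A$-algebra; a morphism $(A,X,\xi)\to(B,Y,\theta)$ is a pair $f:A\to B$, $g:X\to Y$ with $g\circ\xi=\theta\circ T_Bg\circ (T_f)_X$; and $p^T(A,X,\xi)=A$. A 1-cell $(V,\delta)$ induces the fibred functor $(A,X,\xi)\mapsto(A,VX,V\xi\circ\delta)$, and a 2-cell $\nu$ the vertical transformation with components $\nu_X$. **The monad of a pruned fibration.** For a pruned fibration $p$, let $T^p$ be the parametrized monad on $\mathcal E_\varnothing$ with $T^p_A(E_0)=i_R(p_LA+iE_0)$; the unit of $T^p_A$ is the unit $E_0\to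 i_RiE_0$ followed by $i_R$ of the second coprojection, and its multiplication is $i_R$ of the map $p_LA+i\,i_R(p_LA+iE_0)\to p_LA+iE_0$ given by the first coprojection and the counit of $i\dashv i_R$. The *comparison functor* $\eta_p$, from the total category of $p$ to that of $p^{T^p}$, sends $E$ to $(pE,\ i_RE,\ i_R[\varepsilon_E,\varepsilon'_E])$, where $\varepsilon$ and $\varepsilon'$ are the counits of $p_L\dashv p$ and $i\dashv i_R$, and sends $g$ to $(pg,i_Rg)$. **Theorem.** If $p$ is a pruned fibration, then $T^p$ is a pruned parametrized monad, and if $T$ is a pruned parametrized monad, then $p^T$ is a pruned fibration. Moreover: 1. The assignment $p\mapsto T^p$ is the object part of a (strict) 2-functor $L:\mathbf{PFib}(\mathcal A)\to\mathbf{PMnd}(\mathcal A)$, whose value at a fibred functor $H$ has as underlying functor the restriction $H_\varnothing$ of $H$ to the initial fibres; and $L$ is left 2-adjoint to the (strict) 2-functor $R:\mathbf{PMnd}(\mathcal A)\to\mathbf{PFib}(\mathcal A)$, $T\mapsto p^T$, in the following sense: the comparison functors are the components $\eta_p:p\to p^{T^p}$ of a pseudonatural transformation $1\Rightarrow RL$,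 and for each pruned fibration $p$ and each pruned parametrized monad $S$ the functor $$\mathbf{PMnd}(\mathcal A)(T^p,S)\longrightarrow\mathbf{PFib}(\mathcal A)(p,p^S),\qquad K\mapsto R(K)\circ\eta_p,$$ is an equivalence of categories. 2. For each pruned fibration $p$, the unit $\eta_p$ is a fibred functor over $\mathcal A$: $p^{T^p}\circ\eta_p=p$, and $\eta_p$ preserves cartesian morphisms. 3. For each pruned fibration $p$, the functor $\eta_p$ is an equivalence of categories if and only if $p$ is, up to equivalence in $\mathbf{Fib}(\mathcal A)$, the Eilenberg–Moore fibration of a parametrized monad $T$ for which $T_\varnothing$ is isomorphic to the identity monad. -/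

import Mathlib

open CategoryTheory CategoryTheory.Limits

/- Hom types are read off the category structure directly (the removed instance gives the same
quiver structure by a detour through reflexive quivers). -/
attribute [-instance] CategoryTheory.catToReflQuiver

universe w w₁ w₂ v v' v₁ v₂ u u' u₁ u₂

namespace FibMon

section Fib

variable (A : Type u) [Category.{v} A]

set_option linter.checkUnivs false in
/-- A (Grothendieck) fibration over `A`. -/
structure Fib where
  /-- the total category with its projection to `A` -/
  based : BasedCategory.{v', u'} A
  fibered : based.p.IsFibered

variable {A}

/-- The total category of a fibration. -/
abbrev Fib.Total (p : Fib.{v, v', u, u'} A) : Type u' := p.based.obj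

/-- The projection of a fibration. -/
abbrev Fib.proj (p : Fib.{v, v', u, u'} A) : p.Total ⥤ A := p.based.p

instance (p : Fib.{v, v', u, u'} A) : p.proj.IsFibered := p.fibered

/-- A fibred functor over `A`: a functor which strictly commutes with the projections and
preserves cartesian morphisms. -/
structure FibFunctor (p q : Fib.{v, v', u, u'} A) extends BasedFunctor p.based q.based where
  preserves_cartesian : ∀ {a b : A} (f : a ⟶ b) {x y : p.Total} (φ : x ⟶ y),
    p.proj.IsCartesian f φ → q.proj.IsCartesian f (toFunctor.map φ)

/-- The 2-cells between fibred functors over `A` are the vertical natural transformations. -/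
@[ext]
structure FibTrans {p q : Fib.{v, v', u, u'} A} (F G : FibFunctor p q) where
  /-- the underlying natural transformation -/
  nat : F.toFunctor ⟶ G.toFunctor
  vertical : ∀ x : p.Total, q.proj.IsHomLift (𝟙 (p.proj.obj x)) (nat.app x)

@[simps]
instance (p q : Fib.{v, v', u, u'} A) : Category (FibFunctor p q) where
  Hom F G := FibTrans F G
  id F := ⟨𝟙 F.toFunctor, fun x => IsHomLift.id (F.toBasedFunctor.w_obj x)⟩
  comp α β := ⟨α.nat ≫ β.nat, fun x => by
    have := α.vertical x
    have := β.vertical x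
    rw [NatTrans.comp_app]
    infer_instance⟩

theorem FibTrans.hom_ext {p q : Fib.{v, v', u, u'} A} {F G : FibFunctor p q} {α β : F ⟶ G}
    (h : ∀ x, α.nat.app x = β.nat.app x) : α = β :=
  FibTrans.ext (by ext x; exact h x)

/-- The identity fibred functor. -/
@[simps toBasedFunctor]
def FibFunctor.id (p : Fib.{v, v', u, u'} A) : FibFunctor p p where
  toBasedFunctor := BasedFunctor.id p.based
  preserves_cartesian _ _ _ _ h := h

/-- Composition of fibred functors. -/
@[simps toBasedFunctor]
def FibFunctor.comp {p q r : Fib.{v, v', u, u'} A} (F : FibFunctor p q) (G : FibFunctor q r) :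
    FibFunctor p r where
  toBasedFunctor := BasedFunctor.comp F.toBasedFunctor G.toBasedFunctor
  preserves_cartesian f _ _ φ h := G.preserves_cartesian f _ (F.preserves_cartesian f φ h)

/-- An isomorphism of fibred functors with the same underlying functor. -/
@[simps]
def FibFunctor.isoOfEq {p q : Fib.{v, v', u, u'} A} (F G : FibFunctor p q)
    (h : F.toFunctor = G.toFunctor) : F ≅ G where
  hom := ⟨eqToHom h, fun x => by
    rw [eqToHom_app]
    exact IsHomLift.eqToHom_domain_lift_id _ (F.toBasedFunctor.w_obj x)⟩
  inv := ⟨eqToHom h.symm, fun x => by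
    rw [eqToHom_app]
    exact IsHomLift.eqToHom_domain_lift_id _ (G.toBasedFunctor.w_obj x)⟩
  hom_inv_id := FibTrans.ext (by simp)
  inv_hom_id := FibTrans.ext (by simp)

/-- Whiskering of vertical transformations on the left. -/
@[simps]
def FibTrans.whiskerLeft {p q r : Fib.{v, v', u, u'} A} (F : FibFunctor p q)
    {G H : FibFunctor q r} (α : G ⟶ H) : F.comp G ⟶ F.comp H where
  nat := Functor.whiskerLeft F.toFunctor α.nat
  vertical x := by
    have := α.vertical (F.obj x)
    rw [F.toBasedFunctor.w_obj x] at this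
    exact this

/-- Whiskering of vertical transformations on the right. -/
@[simps]
def FibTrans.whiskerRight {p q r : Fib.{v, v', u, u'} A} {F G : FibFunctor p q} (α : F ⟶ G)
    (H : FibFunctor q r) : F.comp H ⟶ G.comp H where
  nat := Functor.whiskerRight α.nat H.toFunctor
  vertical x := by
    have := α.vertical x
    exact H.toBasedFunctor.preserves_isHomLift _ _

/-- The 2-category of fibrations over `A`, fibred functors over `A` and vertical natural
transformations. -/
instance : Bicategory (Fib.{v, v', u, u'} A) where
  Hom p q := FibFunctor p q
  id p := FibFunctor.id p
  comp F G := FibFunctor.comp F G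
  homCategory p q := inferInstanceAs (Category (FibFunctor p q))
  whiskerLeft F _ _ α := FibTrans.whiskerLeft F α
  whiskerRight α H := FibTrans.whiskerRight α H
  associator _ _ _ := FibFunctor.isoOfEq _ _ rfl
  leftUnitor _ := FibFunctor.isoOfEq _ _ rfl
  rightUnitor _ := FibFunctor.isoOfEq _ _ rfl
  whiskerLeft_id _ _ := FibTrans.hom_ext fun _ => rfl
  whiskerLeft_comp _ _ _ _ _ _ := FibTrans.hom_ext fun _ => rfl
  id_whiskerLeft _ := FibTrans.hom_ext fun _ =>
    ((Category.id_comp _).trans (Category.comp_id _)).symm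
  comp_whiskerLeft _ _ _ _ _ := FibTrans.hom_ext fun _ =>
    ((Category.id_comp _).trans (Category.comp_id _)).symm
  id_whiskerRight _ G := FibTrans.hom_ext fun _ => G.toFunctor.map_id _
  comp_whiskerRight _ _ H := FibTrans.hom_ext fun _ => H.toFunctor.map_comp _ _
  whiskerRight_id _ := FibTrans.hom_ext fun _ =>
    ((Category.id_comp _).trans (Category.comp_id _)).symm
  whiskerRight_comp _ _ _ := FibTrans.hom_ext fun _ =>
    ((Category.id_comp _).trans (Category.comp_id _)).symm
  whisker_assoc _ _ _ _ _ := FibTrans.hom_ext fun _ =>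
    ((Category.id_comp _).trans (Category.comp_id _)).symm
  whisker_exchange _ β := FibTrans.hom_ext fun _ => (β.nat.naturality _).symm
  pentagon _ _ _ K := FibTrans.hom_ext fun _ =>
    (congrArg (· ≫ 𝟙 _ ≫ 𝟙 _) (K.toFunctor.map_id _)).trans (Category.id_comp _)
  triangle _ G := FibTrans.hom_ext fun _ =>
    (Category.id_comp _).trans (G.toFunctor.map_id _).symm

instance : Bicategory.Strict (Fib.{v, v', u, u'} A) where
  id_comp _ := rfl
  comp_id _ := rfl
  assoc _ _ _ := rfl
  leftUnitor_eqToIso _ := rfl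
  rightUnitor_eqToIso _ := rfl
  associator_eqToIso _ _ _ := rfl

end Fib

section ParamMonad

variable (A : Type u) [Category.{v} A]

set_option linter.checkUnivs false in
/-- A parametrized monad with category of parameters `A`: a category of carriers `X` together
with a functor from `A` to the category of monads on `X` and monad morphisms. -/
structure ParamMonad where
  /-- the category of carriers -/
  Carrier : Type u'
  [cat : Category.{v'} Carrier]
  /-- the monads `T_a` and the monad morphisms `T_f : T_a ⟶ T_b` for `f : a ⟶ b` -/
  T : A ⥤ Monad Carrier

attribute [instance] ParamMonad.cat

variable {A}

/-- A morphism of parametrized monads over `A`: a functor `V` between the categories of carriers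
together with maps `δ : S_a (V x) ⟶ V (T_a x)`, natural in both variables and compatible with
the units and the multiplications. -/
@[ext]
structure ParamMonadHom (T S : ParamMonad.{v, v', u, u'} A) where
  /-- the functor between the carriers -/
  V : T.Carrier ⥤ S.Carrier
  /-- the comparison cell -/
  δ : ∀ (a : A) (x : T.Carrier), (S.T.obj a).obj (V.obj x) ⟶ V.obj ((T.T.obj a).obj x)
  naturality_carrier : ∀ (a : A) {x y : T.Carrier} (g : x ⟶ y),
    (S.T.obj a).map (V.map g) ≫ δ a y = δ a x ≫ V.map ((T.T.obj a).map g)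
  naturality_param : ∀ {a b : A} (f : a ⟶ b) (x : T.Carrier),
    (S.T.map f).app (V.obj x) ≫ δ b x = δ a x ≫ V.map ((T.T.map f).app x)
  unit : ∀ (a : A) (x : T.Carrier),
    (S.T.obj a).η.app (V.obj x) ≫ δ a x = V.map ((T.T.obj a).η.app x)
  mul : ∀ (a : A) (x : T.Carrier),
    (S.T.obj a).μ.app (V.obj x) ≫ δ a x =
      (S.T.obj a).map (δ a x) ≫ δ a ((T.T.obj a).obj x) ≫ V.map ((T.T.obj a).μ.app x)

/-- A 2-cell between morphisms of parametrized monads over `A`. -/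
@[ext]
structure ParamMonadTrans {T S : ParamMonad.{v, v', u, u'} A} (F G : ParamMonadHom T S) where
  /-- the natural transformation between the functors on carriers -/
  ν : F.V ⟶ G.V
  comm : ∀ (a : A) (x : T.Carrier),
    (S.T.obj a).map (ν.app x) ≫ G.δ a x = F.δ a x ≫ ν.app ((T.T.obj a).obj x)

@[simps]
instance (T S : ParamMonad.{v, v', u, u'} A) : Category (ParamMonadHom T S) where
  Hom F G := ParamMonadTrans F G
  id F := ⟨𝟙 F.V, fun a x => by simp⟩
  comp α β := ⟨α.ν ≫ β.ν, fun a x => by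
    simp only [NatTrans.comp_app, Functor.map_comp, Category.assoc, β.comm]
    rw [← Category.assoc, α.comm, Category.assoc]⟩

theorem ParamMonadTrans.hom_ext {T S : ParamMonad.{v, v', u, u'} A} {F G : ParamMonadHom T S}
    {α β : F ⟶ G} (h : ∀ x, α.ν.app x = β.ν.app x) : α = β :=
  ParamMonadTrans.ext (by ext x; exact h x)

/-- The identity morphism of a parametrized monad. -/
@[simps]
def ParamMonadHom.id (T : ParamMonad.{v, v', u, u'} A) : ParamMonadHom T T where
  V := 𝟭 _
  δ a x := 𝟙 _
  naturality_carrier _ _ _ _ := (Category.comp_id _).trans (Category.id_comp _).symm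
  naturality_param _ _ := (Category.comp_id _).trans (Category.id_comp _).symm
  unit _ _ := Category.comp_id _
  mul a x := by simp

/-- Composition of morphisms of parametrized monads. -/
@[simps]
def ParamMonadHom.comp {T S R : ParamMonad.{v, v', u, u'} A} (F : ParamMonadHom T S)
    (G : ParamMonadHom S R) : ParamMonadHom T R where
  V := F.V ⋙ G.V
  δ a x := G.δ a (F.V.obj x) ≫ G.V.map (F.δ a x)
  naturality_carrier a _ _ g := by
    simp only [Functor.comp_map, Functor.comp_obj, Category.assoc]
    rw [← Category.assoc, G.naturality_carrier, Category.assoc, ← G.V.map_comp,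
      F.naturality_carrier, G.V.map_comp]
  naturality_param f x := by
    simp only [Functor.comp_map, Functor.comp_obj, Category.assoc]
    rw [← Category.assoc, G.naturality_param, Category.assoc, ← G.V.map_comp,
      F.naturality_param, G.V.map_comp]
  unit a x := by
    simp only [Functor.comp_map, Functor.comp_obj]
    rw [← Category.assoc, G.unit, ← G.V.map_comp, F.unit]
  mul a x := by
    simp only [Functor.comp_map, Functor.comp_obj, Functor.map_comp, Category.assoc]
    rw [← Category.assoc, G.mul]
    simp only [Category.assoc]
    rw [← G.V.map_comp, F.mul]
    simp only [Functor.map_comp]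
    rw [← Category.assoc (G.δ a _) (G.V.map _), ← G.naturality_carrier]
    simp only [Category.assoc]

/-- An isomorphism between morphisms of parametrized monads which are equal. -/
@[simps]
def ParamMonadHom.isoOfEq {T S : ParamMonad.{v, v', u, u'} A} (F G : ParamMonadHom T S)
    (h : F = G) : F ≅ G where
  hom := ⟨eqToHom (congrArg ParamMonadHom.V h), by subst h; simp⟩
  inv := ⟨eqToHom (congrArg ParamMonadHom.V h.symm), by subst h; simp⟩
  hom_inv_id := ParamMonadTrans.ext (by simp)
  inv_hom_id := ParamMonadTrans.ext (by simp)

/-- Whiskering on the left. -/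
@[simps]
def ParamMonadTrans.whiskerLeft {T S R : ParamMonad.{v, v', u, u'} A} (F : ParamMonadHom T S)
    {G H : ParamMonadHom S R} (α : G ⟶ H) : F.comp G ⟶ F.comp H where
  ν := Functor.whiskerLeft F.V α.ν
  comm a x := by
    change (R.T.obj a).map (α.ν.app (F.V.obj x)) ≫ H.δ a (F.V.obj x) ≫ H.V.map (F.δ a x) =
      (G.δ a (F.V.obj x) ≫ G.V.map (F.δ a x)) ≫ α.ν.app (F.V.obj ((T.T.obj a).obj x))
    rw [Category.assoc, ← Category.assoc, α.comm, Category.assoc, ← α.ν.naturality]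

/-- Whiskering on the right. -/
@[simps]
def ParamMonadTrans.whiskerRight {T S R : ParamMonad.{v, v', u, u'} A} {F G : ParamMonadHom T S}
    (α : F ⟶ G) (H : ParamMonadHom S R) : F.comp H ⟶ G.comp H where
  ν := Functor.whiskerRight α.ν H.V
  comm a x := by
    change (R.T.obj a).map (H.V.map (α.ν.app x)) ≫ H.δ a (G.V.obj x) ≫ H.V.map (G.δ a x) =
      (H.δ a (F.V.obj x) ≫ H.V.map (F.δ a x)) ≫ H.V.map (α.ν.app ((T.T.obj a).obj x))
    rw [Category.assoc, ← Category.assoc, H.naturality_carrier, Category.assoc, ← H.V.map_comp, α.comm,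
      H.V.map_comp]

theorem ParamMonadHom.id_comp {T S : ParamMonad.{v, v', u, u'} A} (F : ParamMonadHom T S) :
    (ParamMonadHom.id T).comp F = F :=
  ParamMonadHom.ext rfl (heq_of_eq (by funext a x; exact (by simp : F.δ a x ≫ F.V.map (𝟙 _) = F.δ a x)))

theorem ParamMonadHom.comp_id {T S : ParamMonad.{v, v', u, u'} A} (F : ParamMonadHom T S) :
    F.comp (ParamMonadHom.id S) = F :=
  ParamMonadHom.ext rfl (heq_of_eq (by funext a x; exact Category.id_comp (F.δ a x)))

theorem ParamMonadHom.comp_assoc {T S R Q : ParamMonad.{v, v', u, u'} A} (F : ParamMonadHom T S)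
    (G : ParamMonadHom S R) (H : ParamMonadHom R Q) :
    (F.comp G).comp H = F.comp (G.comp H) :=
  ParamMonadHom.ext rfl (heq_of_eq (by
    funext a x
    change H.δ a _ ≫ H.V.map (G.δ a _ ≫ G.V.map (F.δ a x)) =
      (H.δ a _ ≫ H.V.map (G.δ a _)) ≫ H.V.map (G.V.map (F.δ a x))
    simp))

/-- The 2-category of parametrized monads with category of parameters `A`. -/
instance : Bicategory (ParamMonad.{v, v', u, u'} A) where
  Hom T S := ParamMonadHom T S
  id T := ParamMonadHom.id T
  comp F G := F.comp G
  homCategory T S := inferInstanceAs (Category (ParamMonadHom T S))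
  whiskerLeft F _ _ α := ParamMonadTrans.whiskerLeft F α
  whiskerRight α H := ParamMonadTrans.whiskerRight α H
  associator F G H := ParamMonadHom.isoOfEq _ _ (ParamMonadHom.comp_assoc F G H)
  leftUnitor F := ParamMonadHom.isoOfEq _ _ (ParamMonadHom.id_comp F)
  rightUnitor F := ParamMonadHom.isoOfEq _ _ (ParamMonadHom.comp_id F)
  whiskerLeft_id _ _ := ParamMonadTrans.hom_ext fun _ => rfl
  whiskerLeft_comp _ _ _ _ _ _ := ParamMonadTrans.hom_ext fun _ => rfl
  id_whiskerLeft _ := ParamMonadTrans.hom_ext fun _ =>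
    ((Category.id_comp _).trans (Category.comp_id _)).symm
  comp_whiskerLeft _ _ _ _ _ := ParamMonadTrans.hom_ext fun _ =>
    ((Category.id_comp _).trans (Category.comp_id _)).symm
  id_whiskerRight _ G := ParamMonadTrans.hom_ext fun _ => G.V.map_id _
  comp_whiskerRight _ _ H := ParamMonadTrans.hom_ext fun _ => H.V.map_comp _ _
  whiskerRight_id _ := ParamMonadTrans.hom_ext fun _ =>
    ((Category.id_comp _).trans (Category.comp_id _)).symm
  whiskerRight_comp _ _ _ := ParamMonadTrans.hom_ext fun _ =>
    ((Category.id_comp _).trans (Category.comp_id _)).symm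
  whisker_assoc _ _ _ _ _ := ParamMonadTrans.hom_ext fun _ =>
    ((Category.id_comp _).trans (Category.comp_id _)).symm
  whisker_exchange _ β := ParamMonadTrans.hom_ext fun _ => (β.ν.naturality _).symm
  pentagon _ _ _ K := ParamMonadTrans.hom_ext fun _ =>
    (congrArg (· ≫ 𝟙 _ ≫ 𝟙 _) (K.V.map_id _)).trans (Category.id_comp _)
  triangle _ G := ParamMonadTrans.hom_ext fun _ =>
    (Category.id_comp _).trans (G.V.map_id _).symm

theorem ParamMonadHom.isoOfEq_eq {T S : ParamMonad.{v, v', u, u'} A} (F G : ParamMonadHom T S)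
    (h : F = G) : ParamMonadHom.isoOfEq F G h = eqToIso h := by
  subst h; rfl

instance : Bicategory.Strict (ParamMonad.{v, v', u, u'} A) where
  id_comp F := ParamMonadHom.id_comp F
  comp_id F := ParamMonadHom.comp_id F
  assoc F G H := ParamMonadHom.comp_assoc F G H
  leftUnitor_eqToIso _ := ParamMonadHom.isoOfEq_eq _ _ _
  rightUnitor_eqToIso _ := ParamMonadHom.isoOfEq_eq _ _ _
  associator_eqToIso _ _ _ := ParamMonadHom.isoOfEq_eq _ _ _

end ParamMonad

section EilenbergMoore

variable {A : Type u} [Category.{v} A] {X : Type u'} [Category.{v'} X]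

/-- An object of the total category of the Eilenberg–Moore fibration of a parametrized monad `T`:
an object `a` of `A` together with an Eilenberg–Moore algebra of the monad `T_a`. -/
structure EMObj (T : A ⥤ Monad X) where
  /-- the parameter -/
  base : A
  /-- the algebra -/
  alg : (T.obj base).Algebra

/-- A morphism `(a, x, ξ) ⟶ (b, y, θ)` is a pair `f : a ⟶ b`, `g : x ⟶ y` such that
`g ∘ ξ = θ ∘ T_f g`. -/
@[ext]
structure EMHom {T : A ⥤ Monad X} (P Q : EMObj T) where
  /-- the component in the category of parameters -/
  base : P.base ⟶ Q.base
  /-- the component in the category of carriers -/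
  carrier : P.alg.A ⟶ Q.alg.A
  comm : (T.map base).app P.alg.A ≫ (T.obj Q.base).map carrier ≫ Q.alg.a = P.alg.a ≫ carrier

@[simps]
instance (T : A ⥤ Monad X) : Category (EMObj T) where
  Hom P Q := EMHom P Q
  id P := ⟨𝟙 _, 𝟙 _, by simp⟩
  comp {P Q R} f g := ⟨f.base ≫ g.base, f.carrier ≫ g.carrier, by
    have h := (T.map g.base).naturality f.carrier
    simp only [Functor.map_comp, MonadHom.comp_toNatTrans, NatTrans.comp_app, Category.assoc]
    rw [← reassoc_of% h, g.comm, reassoc_of% f.comm]⟩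

theorem EMHom.hom_ext {T : A ⥤ Monad X} {P Q : EMObj T} {f g : P ⟶ Q} (h₁ : f.base = g.base)
    (h₂ : f.carrier = g.carrier) : f = g :=
  EMHom.ext h₁ h₂

/-- The projection of the Eilenberg–Moore fibration. -/
@[simps]
def emProj (T : A ⥤ Monad X) : EMObj T ⥤ A where
  obj P := P.base
  map f := f.base

/-- The reindexing `(x, ξ ∘ T_f x)` of an algebra `(x, ξ)` of `T_b` along `f : a ⟶ b`. -/
@[simps]
def EMObj.reindex {T : A ⥤ Monad X} (P : EMObj T) {a : A} (f : a ⟶ P.base) : EMObj T where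
  base := a
  alg :=
    { A := P.alg.A
      a := (T.map f).app P.alg.A ≫ P.alg.a
      unit := by rw [← Category.assoc, (T.map f).app_η, P.alg.unit]
      assoc := by
        have h := (T.map f).naturality P.alg.a
        rw [← Category.assoc, (T.map f).app_μ]
        simp only [Category.assoc, Functor.map_comp]
        rw [P.alg.assoc, ← reassoc_of% h] }

/-- The canonical morphism out of a reindexing. -/
@[simps]
def EMObj.reindexHom {T : A ⥤ Monad X} (P : EMObj T) {a : A} (f : a ⟶ P.base) :
    P.reindex f ⟶ P where
  base := f
  carrier := 𝟙 P.alg.A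
  comm := by
    change (T.map f).app P.alg.A ≫ (T.obj P.base).map (𝟙 P.alg.A) ≫ P.alg.a =
      ((T.map f).app P.alg.A ≫ P.alg.a) ≫ 𝟙 P.alg.A
    simp

theorem emProj_isHomLift_iff {T : A ⥤ Monad X} {P Q : EMObj T} (φ : P ⟶ Q)
    (f : P.base ⟶ Q.base) : (emProj T).IsHomLift f φ ↔ φ.base = f :=
  ⟨fun h => (@IsHomLift.eq_of_isHomLift _ _ _ _ (emProj T) P Q f φ h).symm, fun h => by
    subst h; exact IsHomLift.map (emProj T) φ⟩

/-- A morphism of the Eilenberg–Moore fibration whose carrier component is invertible is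
cartesian. -/
theorem emProj_isStronglyCartesian {T : A ⥤ Monad X} {P Q : EMObj T} (φ : P ⟶ Q)
    [IsIso φ.carrier] : (emProj T).IsStronglyCartesian φ.base φ where
  toIsHomLift := IsHomLift.map (emProj T) φ
  universal_property' {R} g ψ hψ := by
    have hb : ψ.base = g ≫ φ.base := (emProj_isHomLift_iff ψ _).1 hψ
    refine ⟨⟨g, ψ.carrier ≫ inv φ.carrier, ?_⟩, ⟨(emProj_isHomLift_iff _ _).2 rfl, ?_⟩, ?_⟩
    · rw [← cancel_mono φ.carrier]
      have h₁ : (T.map (g ≫ φ.base)).app R.alg.A ≫ (T.obj Q.base).map ψ.carrier ≫ Q.alg.a =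
          R.alg.a ≫ ψ.carrier := hb ▸ ψ.comm
      have h₃ := (T.map φ.base).naturality (ψ.carrier ≫ inv φ.carrier)
      simp only [Category.assoc, IsIso.inv_hom_id, Category.comp_id]
      rw [← φ.comm, reassoc_of% h₃, ← Functor.map_comp_assoc, Category.assoc,
        IsIso.inv_hom_id, Category.comp_id, ← h₁]
      simp only [Functor.map_comp, MonadHom.comp_toNatTrans, NatTrans.comp_app, Category.assoc]
      rfl
    · exact EMHom.hom_ext hb.symm (by simp)
    · rintro χ ⟨hχ, hc⟩
      refine EMHom.hom_ext ((emProj_isHomLift_iff χ _).1 hχ) ?_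
      have hc' : χ.carrier ≫ φ.carrier = ψ.carrier := congrArg EMHom.carrier hc
      change χ.carrier = ψ.carrier ≫ inv φ.carrier
      rw [← hc', Category.assoc, IsIso.hom_inv_id, Category.comp_id]

instance (T : A ⥤ Monad X) : (emProj T).IsFibered :=
  Functor.IsFibered.of_exists_isStronglyCartesian fun P _ f =>
    ⟨P.reindex f, P.reindexHom f, by
      have : IsIso (P.reindexHom f).carrier := inferInstanceAs (IsIso (𝟙 _))
      exact emProj_isStronglyCartesian (P.reindexHom f)⟩

/-- The functor taking the carrier of an algebra. -/
@[simps]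
def emCarrier (T : A ⥤ Monad X) : EMObj T ⥤ X where
  obj P := P.alg.A
  map f := f.carrier

theorem emProj_isIso_carrier {T : A ⥤ Monad X} {P Q : EMObj T} (φ : P ⟶ Q) {a b : A} (f : a ⟶ b)
    (h : (emProj T).IsCartesian f φ) : IsIso φ.carrier := by
  subst_hom_lift (emProj T) f φ
  have : IsIso (Q.reindexHom φ.base).carrier := inferInstanceAs (IsIso (𝟙 _))
  have h₁ : (emProj T).IsStronglyCartesian φ.base (Q.reindexHom φ.base) :=
    emProj_isStronglyCartesian (Q.reindexHom φ.base)
  have h₂ : (emProj T).IsCartesian ((emProj T).map φ) (Q.reindexHom φ.base) :=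
    Functor.IsStronglyCartesian.isCartesian_of_isStronglyCartesian (emProj T) φ.base _
  let e := Functor.IsCartesian.domainUniqueUpToIso (emProj T) ((emProj T).map φ)
    (Q.reindexHom φ.base) φ
  have he : e.hom ≫ Q.reindexHom φ.base = φ := Functor.IsCartesian.fac (emProj T) ((emProj T).map φ) _ φ
  have h₃ : IsIso ((emCarrier T).map (e.hom ≫ Q.reindexHom φ.base)) := by
    rw [Functor.map_comp]
    have : IsIso ((emCarrier T).map (Q.reindexHom φ.base)) := inferInstanceAs (IsIso (𝟙 _))
    infer_instance
  rw [he] at h₃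
  exact h₃

end EilenbergMoore

section EMFunctor

variable {A : Type u} [Category.{v} A]

/-- The Eilenberg–Moore fibration of a parametrized monad. -/
@[simps]
def emFib (T : ParamMonad.{v, v', u, u'} A) : Fib.{v, max v v', u, max u u' v'} A where
  based := BasedCategory.ofFunctor (emProj T.T)
  fibered := inferInstanceAs (emProj T.T).IsFibered

/-- The algebra `(V x, V ξ ∘ δ)` of `S_a` induced by an algebra `(x, ξ)` of `T_a` along a morphism
`(V, δ)` of parametrized monads. -/
@[simps]
def ParamMonadHom.mapAlg {T S : ParamMonad.{v, v', u, u'} A} (F : ParamMonadHom T S) {a : A}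
    (P : (T.T.obj a).Algebra) : (S.T.obj a).Algebra where
  A := F.V.obj P.A
  a := F.δ a P.A ≫ F.V.map P.a
  unit := by
    rw [← Category.assoc, F.unit, ← F.V.map_comp, P.unit]
    exact F.V.map_id _
  assoc := by
    have h := F.naturality_carrier a P.a
    rw [← Category.assoc, F.mul]
    simp only [Functor.map_comp, Category.assoc]
    rw [reassoc_of% h, ← F.V.map_comp, ← F.V.map_comp, P.assoc]

/-- The functor `(a, x, ξ) ↦ (a, V x, V ξ ∘ δ)` between Eilenberg–Moore fibrations induced by a
morphism `(V, δ)` of parametrized monads. -/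
@[simps]
def emMapFunctor {T S : ParamMonad.{v, v', u, u'} A} (F : ParamMonadHom T S) :
    EMObj T.T ⥤ EMObj S.T where
  obj P := { base := P.base, alg := F.mapAlg P.alg }
  map {P Q} f :=
    { base := f.base
      carrier := F.V.map f.carrier
      comm := by
        have h₁ := F.naturality_carrier Q.base f.carrier
        have h₂ := F.naturality_param f.base P.alg.A
        change (S.T.map f.base).app (F.V.obj P.alg.A) ≫ (S.T.obj Q.base).map (F.V.map f.carrier) ≫
          F.δ Q.base Q.alg.A ≫ F.V.map Q.alg.a =
          (F.δ P.base P.alg.A ≫ F.V.map P.alg.a) ≫ F.V.map f.carrier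
        rw [reassoc_of% h₁, reassoc_of% h₂, ← F.V.map_comp, ← F.V.map_comp, f.comm,
          F.V.map_comp, Category.assoc] }
  map_id P := EMHom.hom_ext rfl (F.V.map_id _)
  map_comp f g := EMHom.hom_ext rfl (F.V.map_comp _ _)

theorem emMapFunctor_isCartesian {T S : ParamMonad.{v, v', u, u'} A} (F : ParamMonadHom T S)
    {a b : A} (f : a ⟶ b) {P Q : EMObj T.T} (φ : P ⟶ Q) (h : (emProj T.T).IsCartesian f φ) :
    (emProj S.T).IsCartesian f ((emMapFunctor F).map φ) := by
  have hi : IsIso φ.carrier := emProj_isIso_carrier φ f h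
  subst_hom_lift (emProj T.T) f φ
  have : IsIso ((emMapFunctor F).map φ).carrier := inferInstanceAs (IsIso (F.V.map _))
  have h₁ := emProj_isStronglyCartesian ((emMapFunctor F).map φ)
  exact @Functor.IsStronglyCartesian.isCartesian_of_isStronglyCartesian _ _ _ _ _ _ _ _ _ _ _ h₁

/-- The fibred functor between Eilenberg–Moore fibrations induced by a morphism of parametrized
monads. -/
@[simps toBasedFunctor]
def emMap {T S : ParamMonad.{v, v', u, u'} A} (F : ParamMonadHom T S) :
    FibFunctor (emFib T) (emFib S) where
  toBasedFunctor := { toFunctor := emMapFunctor F, w := rfl }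
  preserves_cartesian f _ _ φ h := emMapFunctor_isCartesian F f φ h

/-- The vertical transformation with components `(𝟙, ν)` induced by a 2-cell `ν`. -/
def emMap₂ {T S : ParamMonad.{v, v', u, u'} A} {F G : ParamMonadHom T S} (α : F ⟶ G) :
    emMap F ⟶ emMap G where
  nat :=
    { app := fun P => EMHom.mk (P := (emMapFunctor F).obj P) (Q := (emMapFunctor G).obj P)
        (𝟙 _) (α.ν.app P.alg.A) (by
          have h := α.comm P.base P.alg.A
          change (S.T.map (𝟙 P.base)).app (F.V.obj P.alg.A) ≫
            (S.T.obj P.base).map (α.ν.app P.alg.A) ≫ G.δ P.base P.alg.A ≫ G.V.map P.alg.a =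
            (F.δ P.base P.alg.A ≫ F.V.map P.alg.a) ≫ α.ν.app P.alg.A
          rw [reassoc_of% h, ← α.ν.naturality]
          simp)
      naturality := fun P Q f => EMHom.hom_ext
        ((Category.comp_id _).trans (Category.id_comp _).symm) (α.ν.naturality _) }
  vertical P := (emProj_isHomLift_iff _ _).2 rfl

@[simp]
theorem emMap₂_nat_app_base {T S : ParamMonad.{v, v', u, u'} A} {F G : ParamMonadHom T S}
    (α : F ⟶ G) (P : EMObj T.T) : EMHom.base ((emMap₂ α).nat.app P) = 𝟙 P.base := rfl

@[simp]
theorem emMap₂_nat_app_carrier {T S : ParamMonad.{v, v', u, u'} A} {F G : ParamMonadHom T S}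
    (α : F ⟶ G) (P : EMObj T.T) :
    EMHom.carrier ((emMap₂ α).nat.app P) = α.ν.app P.alg.A := rfl

theorem EMHom.heq {X : Type u'} [Category.{v'} X] {T : A ⥤ Monad X} {P P' Q Q' : EMObj T}
    (hP : P = P') (hQ : Q = Q') {f : P ⟶ Q} {g : P' ⟶ Q'} (h₁ : f.base ≍ g.base)
    (h₂ : f.carrier ≍ g.carrier) : f ≍ g := by
  subst hP hQ
  exact heq_of_eq (EMHom.hom_ext (eq_of_heq h₁) (eq_of_heq h₂))

theorem EMObj.eq_mk {X : Type u'} [Category.{v'} X] {T : A ⥤ Monad X} {a : A}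
    {P Q : (T.obj a).Algebra} (h : P = Q) : EMObj.mk (T := T) a P = EMObj.mk a Q := by
  rw [h]

theorem ParamMonadHom.id_mapAlg {T : ParamMonad.{v, v', u, u'} A} {a : A}
    (P : (T.T.obj a).Algebra) : (ParamMonadHom.id T).mapAlg P = P := by
  cases P
  simp only [ParamMonadHom.mapAlg, Monad.Algebra.mk.injEq]
  exact ⟨rfl, heq_of_eq (Category.id_comp _)⟩

theorem ParamMonadHom.comp_mapAlg {T S R : ParamMonad.{v, v', u, u'} A} (F : ParamMonadHom T S)
    (G : ParamMonadHom S R) {a : A} (P : (T.T.obj a).Algebra) :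
    (F.comp G).mapAlg P = G.mapAlg (F.mapAlg P) := by
  cases P
  simp only [ParamMonadHom.mapAlg, Monad.Algebra.mk.injEq]
  refine ⟨rfl, heq_of_eq ?_⟩
  change (G.δ a _ ≫ G.V.map (F.δ a _)) ≫ G.V.map (F.V.map _) =
    G.δ a _ ≫ G.V.map (F.δ a _ ≫ F.V.map _)
  rw [G.V.map_comp, Category.assoc]

theorem FibFunctor.eq_of_toFunctor {p q : Fib.{v, v', u, u'} A} {F G : FibFunctor p q}
    (h : F.toFunctor = G.toFunctor) : F = G := by
  obtain ⟨⟨F, hF⟩, hF'⟩ := F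
  obtain ⟨⟨G, hG⟩, hG'⟩ := G
  obtain rfl : F = G := h
  rfl

theorem emMap_id (T : ParamMonad.{v, v', u, u'} A) :
    emMap (ParamMonadHom.id T) = FibFunctor.id (emFib T) :=
  FibFunctor.eq_of_toFunctor (Functor.hext
    (fun P => EMObj.eq_mk (ParamMonadHom.id_mapAlg P.alg))
    (fun P Q _ => EMHom.heq (EMObj.eq_mk (ParamMonadHom.id_mapAlg P.alg))
      (EMObj.eq_mk (ParamMonadHom.id_mapAlg Q.alg)) HEq.rfl HEq.rfl))

theorem emMap_comp {T S R : ParamMonad.{v, v', u, u'} A} (F : ParamMonadHom T S)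
    (G : ParamMonadHom S R) : emMap (F.comp G) = (emMap F).comp (emMap G) :=
  FibFunctor.eq_of_toFunctor (Functor.hext
    (fun P => EMObj.eq_mk (ParamMonadHom.comp_mapAlg F G P.alg))
    (fun P Q _ => EMHom.heq (EMObj.eq_mk (ParamMonadHom.comp_mapAlg F G P.alg))
      (EMObj.eq_mk (ParamMonadHom.comp_mapAlg F G Q.alg)) HEq.rfl HEq.rfl))

theorem emFib_eqToHom_carrier {T S : ParamMonad.{v, v', u, u'} A}
    {F G : FibFunctor (emFib T) (emFib S)} (h : F = G) (P : EMObj T.T) :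
    EMHom.carrier (FibTrans.nat (eqToHom h) |>.app P) =
      eqToHom (congrArg (fun K : FibFunctor (emFib T) (emFib S) =>
        ((K.obj P : EMObj S.T)).alg.A) h) := by
  subst h; rfl

theorem emFib_eqToHom_base {T S : ParamMonad.{v, v', u, u'} A}
    {F G : FibFunctor (emFib T) (emFib S)} (h : F = G) (P : EMObj T.T) :
    EMHom.base (FibTrans.nat (eqToHom h) |>.app P) =
      eqToHom (congrArg (fun K : FibFunctor (emFib T) (emFib S) =>
        ((K.obj P : EMObj S.T)).base) h) := by
  subst h; rfl

/-- The 2-functor sending a parametrized monad to its Eilenberg–Moore fibration. -/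
def emTwoFunctor (A : Type u) [Category.{v} A] :
    StrictPseudofunctor (ParamMonad.{v, v', u, u'} A) (Fib.{v, max v v', u, max u u' v'} A) :=
  StrictPseudofunctor.mk''
    { obj := fun T => emFib T
      map := fun F => emMap F
      map₂ := fun α => emMap₂ α
      map₂_id := fun _ => FibTrans.hom_ext fun _ => rfl
      map₂_comp := fun _ _ => FibTrans.hom_ext fun _ => EMHom.hom_ext
        (Category.comp_id _).symm rfl
      map_id := fun T => emMap_id T
      map_comp := fun F G => emMap_comp F G
      map₂_whisker_left := fun F G H α => FibTrans.hom_ext fun P =>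
        EMHom.hom_ext
          (((congrArg₂ (fun a b => a ≫ 𝟙 P.base ≫ b) (emFib_eqToHom_base (emMap_comp F G) P)
            (emFib_eqToHom_base (emMap_comp F H).symm P)).trans
            ((Category.id_comp _).trans (Category.comp_id _))).symm)
          (((congrArg₂ (fun a b => a ≫ α.ν.app (F.V.obj P.alg.A) ≫ b)
            (emFib_eqToHom_carrier (emMap_comp F G) P)
            (emFib_eqToHom_carrier (emMap_comp F H).symm P)).trans
            ((Category.id_comp _).trans (Category.comp_id _))).symm)
      map₂_whisker_right := fun {_ _ _ F G} α H => FibTrans.hom_ext fun P =>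
        EMHom.hom_ext
          (((congrArg₂ (fun a b => a ≫ 𝟙 P.base ≫ b) (emFib_eqToHom_base (emMap_comp F H) P)
            (emFib_eqToHom_base (emMap_comp G H).symm P)).trans
            ((Category.id_comp _).trans (Category.comp_id _))).symm)
          (((congrArg₂ (fun a b => a ≫ H.V.map (α.ν.app P.alg.A) ≫ b)
            (emFib_eqToHom_carrier (emMap_comp F H) P)
            (emFib_eqToHom_carrier (emMap_comp G H).symm P)).trans
            ((Category.id_comp _).trans (Category.comp_id _))).symm) }

end EMFunctor

section Pruned

variable {A : Type u} [Category.{v} A] [HasInitial A] {E : Type u'} [Category.{v'} E]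

/-- The initial fibre of a functor to a category with an initial object. -/
noncomputable abbrev InitialFibre (p : E ⥤ A) : Type u' := p.Fiber (⊥_ A)

/-- The inclusion `i` of the initial fibre. -/
noncomputable abbrev fibreIncl (p : E ⥤ A) : InitialFibre p ⥤ E := Functor.Fiber.fiberInclusion

/-- The inclusion of the initial fibre of a fibration has a right adjoint. -/
instance fibreIncl_isLeftAdjoint (p : E ⥤ A) [p.IsFibered] : (fibreIncl p).IsLeftAdjoint := by
  have (e : E) : HasTerminal (CostructuredArrow (fibreIncl p) e) := by
    obtain ⟨b, φ, hφ⟩ :=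
      Functor.IsPreFibered.exists_isCartesian' (p := p) (initial.to (p.obj e))
    have hl (Z : CostructuredArrow (fibreIncl p) e) :
        p.IsHomLift (b := e) (initial.to (p.obj e)) Z.hom :=
      IsHomLift.of_fac p _ _ Z.left.2 rfl (Subsingleton.elim _ _)
    refine IsTerminal.hasTerminal (X := CostructuredArrow.mk
      (Y := Functor.Fiber.mk (IsHomLift.domain_eq p (initial.to (p.obj e)) φ)) φ)
      (IsTerminal.ofUniqueHom (fun Z => ?_) (fun Z g => ?_))
    · exact CostructuredArrow.homMk
        ⟨@Functor.IsCartesian.map _ _ _ _ p _ _ _ _ _ φ hφ _ Z.hom (hl Z),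
          @Functor.IsCartesian.map_isHomLift _ _ _ _ p _ _ _ _ _ φ hφ _ Z.hom (hl Z)⟩
        (@Functor.IsCartesian.fac _ _ _ _ p _ _ _ _ _ φ hφ _ Z.hom (hl Z))
    · exact CostructuredArrow.hom_ext _ _ (Subtype.ext
        (@Functor.IsCartesian.map_uniq _ _ _ _ p _ _ _ _ _ φ hφ _ Z.hom (hl Z) g.left.1
          g.left.2 (CostructuredArrow.w g)))
  exact isLeftAdjoint_of_costructuredArrowTerminals _

/-- The right adjoint `i_R` of the inclusion of the initial fibre of a fibration. -/
noncomputable def fibreCorefl (p : E ⥤ A) [p.IsFibered] : E ⥤ InitialFibre p :=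
  (fibreIncl p).rightAdjoint

/-- The adjunction `i ⊣ i_R`. -/
noncomputable def fibreAdj (p : E ⥤ A) [p.IsFibered] : fibreIncl p ⊣ fibreCorefl p :=
  Adjunction.ofIsLeftAdjoint _

/-- A functor `p` to a category with initial object `∅` is pruned if it has a full and faithful
left adjoint `p_L`, the coproducts `p_L a + i e` exist for all `a` in the base and all `e` in the
fibre over `∅`, and `p` preserves these coproducts. -/
class IsPruned (p : E ⥤ A) : Prop where
  isRightAdjoint : p.IsRightAdjoint
  full : p.leftAdjoint.Full
  faithful : p.leftAdjoint.Faithful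
  hasCoproduct : ∀ (a : A) (e : InitialFibre p),
    HasBinaryCoproduct (p.leftAdjoint.obj a) ((fibreIncl p).obj e)
  preservesCoproduct : ∀ (a : A) (e : InitialFibre p),
    PreservesColimit (pair (p.leftAdjoint.obj a) ((fibreIncl p).obj e)) p

attribute [instance] IsPruned.isRightAdjoint IsPruned.full IsPruned.faithful
  IsPruned.hasCoproduct IsPruned.preservesCoproduct

variable (p : E ⥤ A) [p.IsFibered] [IsPruned p]

/-- The coproduct `p_L a + i e`. -/
noncomputable abbrev sumObj (a : A) (e : InitialFibre p) : E :=
  p.leftAdjoint.obj a ⨿ (fibreIncl p).obj e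

/-- The adjunction `p_L ⊣ p`. -/
noncomputable abbrev projAdj : p.leftAdjoint ⊣ p := Adjunction.ofIsRightAdjoint p

/-- The map `p_L a + i (i_R (p_L a + i e)) ⟶ p_L a + i e` given by the first coprojection and the
counit of `i ⊣ i_R`. -/
noncomputable abbrev sumMul (a : A) (e : InitialFibre p) :
    sumObj p a ((fibreCorefl p).obj (sumObj p a e)) ⟶ sumObj p a e :=
  coprod.desc coprod.inl ((fibreAdj p).counit.app (sumObj p a e))

/-- The monad `T^p_a` on the initial fibre, with `T^p_a e = i_R (p_L a + i e)`. -/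
@[simps]
noncomputable def fibMonad (a : A) : Monad (InitialFibre p) where
  obj e := (fibreCorefl p).obj (sumObj p a e)
  map g := (fibreCorefl p).map (coprod.map (𝟙 _) ((fibreIncl p).map g))
  map_id e := by simp
  map_comp f g := by simp [← Functor.map_comp]
  η :=
    { app := fun e => (fibreAdj p).unit.app e ≫ (fibreCorefl p).map coprod.inr
      naturality := fun e e' g => by
        have h := (fibreAdj p).unit.naturality g
        dsimp at h ⊢
        rw [reassoc_of% h, Category.assoc, ← Functor.map_comp, ← Functor.map_comp,
          coprod.inr_map] }
  μ :=
    { app := fun e => (fibreCorefl p).map (sumMul p a e)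
      naturality := fun e e' g => by
        dsimp
        rw [← Functor.map_comp, ← Functor.map_comp]
        congr 1
        ext <;> simp }
  assoc e := by
    dsimp
    rw [← Functor.map_comp, ← Functor.map_comp]
    refine congrArg (fibreCorefl p).map (coprod.hom_ext ?_ ?_)
    · rw [coprod.inl_map_assoc, Category.id_comp, coprod.inl_desc, coprod.inl_desc_assoc,
        coprod.inl_desc]
    · rw [coprod.inr_map_assoc, coprod.inr_desc, coprod.inr_desc_assoc]
      exact (fibreAdj p).counit.naturality _
  left_unit e := by
    dsimp
    rw [Category.assoc, ← Functor.map_comp, coprod.inr_desc]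
    exact (fibreAdj p).right_triangle_components _
  right_unit e := by
    dsimp
    rw [← Functor.map_comp, ← (fibreCorefl p).map_id]
    refine congrArg (fibreCorefl p).map (coprod.hom_ext ?_ ?_)
    · rw [coprod.inl_map_assoc, Category.id_comp, coprod.inl_desc, Category.comp_id]
    · simp

theorem fibParamMonad_naturality {a b : A} (f : a ⟶ b) {e e' : InitialFibre p} (g : e ⟶ e') :
    (fibreCorefl p).map (coprod.map (𝟙 (p.leftAdjoint.obj a)) ((fibreIncl p).map g)) ≫
      (fibreCorefl p).map (coprod.map (p.leftAdjoint.map f) (𝟙 ((fibreIncl p).obj e'))) =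
    (fibreCorefl p).map (coprod.map (p.leftAdjoint.map f) (𝟙 ((fibreIncl p).obj e))) ≫
      (fibreCorefl p).map (coprod.map (𝟙 (p.leftAdjoint.obj b)) ((fibreIncl p).map g)) := by
  rw [← Functor.map_comp, ← Functor.map_comp]
  simp

theorem fibParamMonad_unit {a b : A} (f : a ⟶ b) (e : InitialFibre p) :
    ((fibreAdj p).unit.app e ≫ (fibreCorefl p).map (coprod.inr : _ ⟶ sumObj p a e)) ≫
      (fibreCorefl p).map (coprod.map (p.leftAdjoint.map f) (𝟙 ((fibreIncl p).obj e))) =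
    (fibreAdj p).unit.app e ≫ (fibreCorefl p).map (coprod.inr : _ ⟶ sumObj p b e) := by
  rw [Category.assoc]
  refine congrArg ((fibreAdj p).unit.app e ≫ ·) ?_
  exact ((fibreCorefl p).map_comp _ _).symm.trans
    (congrArg (fibreCorefl p).map ((coprod.inr_map _ _).trans (Category.id_comp _)))

theorem fibParamMonad_mul {a b : A} (f : a ⟶ b) (e : InitialFibre p) :
    (fibreCorefl p).map (sumMul p a e) ≫
      (fibreCorefl p).map (coprod.map (p.leftAdjoint.map f) (𝟙 ((fibreIncl p).obj e))) =
    ((fibreCorefl p).map (coprod.map (𝟙 (p.leftAdjoint.obj a)) ((fibreIncl p).map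
        ((fibreCorefl p).map (coprod.map (p.leftAdjoint.map f) (𝟙 ((fibreIncl p).obj e)))))) ≫
      (fibreCorefl p).map (coprod.map (p.leftAdjoint.map f)
        (𝟙 ((fibreIncl p).obj ((fibreCorefl p).obj (sumObj p b e)))))) ≫
      (fibreCorefl p).map (sumMul p b e) := by
  rw [← Functor.map_comp, ← Functor.map_comp, ← Functor.map_comp]
  refine congrArg (fibreCorefl p).map (coprod.hom_ext ?_ ?_)
  · simp
  · simp

/-- The parametrized monad `T^p` on the initial fibre of a pruned fibration `p`. -/
@[simps]
noncomputable def fibParamMonad : A ⥤ Monad (InitialFibre p) where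
  obj a := fibMonad p a
  map f :=
    { app := fun e => (fibreCorefl p).map (coprod.map (p.leftAdjoint.map f) (𝟙 _))
      naturality := fun _ _ g => fibParamMonad_naturality p f g
      app_η := fun e => fibParamMonad_unit p f e
      app_μ := fun e => fibParamMonad_mul p f e }
  map_id a := MonadHom.ext (funext fun e => by
    change (fibreCorefl p).map (coprod.map (p.leftAdjoint.map (𝟙 a)) (𝟙 _)) = 𝟙 _
    simp)
  map_comp f g := MonadHom.ext (funext fun e => by
    change (fibreCorefl p).map (coprod.map (p.leftAdjoint.map (f ≫ g)) (𝟙 _)) =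
      (fibreCorefl p).map _ ≫ (fibreCorefl p).map _
    rw [← Functor.map_comp]
    simp)

/-- The map `p_L (p e) + i (i_R e) ⟶ e` given by the counits of `p_L ⊣ p` and `i ⊣ i_R`. -/
noncomputable abbrev sumCounit (e : E) : sumObj p (p.obj e) ((fibreCorefl p).obj e) ⟶ e :=
  coprod.desc ((projAdj p).counit.app e) ((fibreAdj p).counit.app e)

theorem sumCounit_unit (e : E) :
    ((fibreAdj p).unit.app ((fibreCorefl p).obj e) ≫ (fibreCorefl p).map coprod.inr) ≫
      (fibreCorefl p).map (sumCounit p e) = 𝟙 ((fibreCorefl p).obj e) := by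
  rw [Category.assoc]
  refine Eq.trans (congrArg ((fibreAdj p).unit.app ((fibreCorefl p).obj e) ≫ ·) ?_)
    ((fibreAdj p).right_triangle_components e)
  exact ((fibreCorefl p).map_comp _ _).symm.trans
    (congrArg (fibreCorefl p).map (coprod.inr_desc _ _))

theorem sumCounit_mul (e : E) :
    (fibreCorefl p).map (sumMul p (p.obj e) ((fibreCorefl p).obj e)) ≫
      (fibreCorefl p).map (sumCounit p e) =
    (fibreCorefl p).map (coprod.map (𝟙 (p.leftAdjoint.obj (p.obj e)))
        ((fibreIncl p).map ((fibreCorefl p).map (sumCounit p e)))) ≫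
      (fibreCorefl p).map (sumCounit p e) := by
  rw [← Functor.map_comp, ← Functor.map_comp]
  refine congrArg (fibreCorefl p).map (coprod.hom_ext ?_ ?_)
  · rw [coprod.inl_map_assoc, Category.id_comp, coprod.inl_desc, coprod.inl_desc_assoc,
      coprod.inl_desc]
  · rw [coprod.inr_map_assoc, coprod.inr_desc, coprod.inr_desc_assoc]
    exact ((fibreAdj p).counit.naturality _).symm

theorem sumCounit_naturality {e e' : E} (g : e ⟶ e') :
    (fibreCorefl p).map (coprod.map (p.leftAdjoint.map (p.map g))
        (𝟙 ((fibreIncl p).obj ((fibreCorefl p).obj e)))) ≫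
      (fibreCorefl p).map (coprod.map (𝟙 (p.leftAdjoint.obj (p.obj e')))
        ((fibreIncl p).map ((fibreCorefl p).map g))) ≫ (fibreCorefl p).map (sumCounit p e') =
    (fibreCorefl p).map (sumCounit p e) ≫ (fibreCorefl p).map g := by
  rw [← Functor.map_comp, ← Functor.map_comp, ← Functor.map_comp]
  refine congrArg (fibreCorefl p).map (coprod.hom_ext ?_ ?_)
  · simp
  · simp

/-- The algebra of `T^p_{p e}` on `i_R e` with structure map
`i_R (p_L (p e) + i (i_R e)) ⟶ i_R e` given by the counits of `p_L ⊣ p` and `i ⊣ i_R`. -/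
@[simps]
noncomputable def comparisonAlg (e : E) : (fibMonad p (p.obj e)).Algebra where
  A := (fibreCorefl p).obj e
  a := (fibreCorefl p).map (sumCounit p e)
  unit := sumCounit_unit p e
  assoc := sumCounit_mul p e

/-- The comparison functor of a pruned fibration `p : E ⥤ A`: it sends `e` to the object `i_R e`
with its canonical algebra structure over `p e`. -/
@[simps]
noncomputable def comparison : E ⥤ EMObj (fibParamMonad p) where
  obj e := { base := p.obj e, alg := comparisonAlg p e }
  map g :=
    { base := p.map g
      carrier := (fibreCorefl p).map g
      comm := sumCounit_naturality p g }
  map_id e := EMHom.hom_ext (p.map_id e) ((fibreCorefl p).map_id e)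
  map_comp f g := EMHom.hom_ext (p.map_comp f g) ((fibreCorefl p).map_comp f g)

end Pruned

section PrunedMonad

variable {A : Type u} [Category.{v} A] [HasInitial A]

/-- A parametrized monad is pruned if its category of carriers has an initial object and the monad
`T_∅` is isomorphic to the identity monad. -/
def IsPrunedMonad {X : Type u'} [Category.{v'} X] (T : A ⥤ Monad X) : Prop :=
  HasInitial X ∧ Nonempty (T.obj (⊥_ A) ≅ Monad.id X)

variable {E : Type u'} [Category.{v'} E] (p : E ⥤ A)

instance : (fibreIncl p).Full where
  map_surjective {x y} g := ⟨⟨g, IsHomLift.of_fac p _ _ x.2 y.2 (Subsingleton.elim _ _)⟩, rfl⟩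

instance : (fibreIncl p).Faithful where
  map_injective h := Subtype.ext h

variable [p.IsFibered] [IsPruned p]

noncomputable def leftAdjointBotIsInitial : IsInitial (p.leftAdjoint.obj (⊥_ A)) :=
  (initialIsInitial (C := A)).isInitialObj p.leftAdjoint

theorem hasInitial_initialFibre : HasInitial (InitialFibre p) := by
  have hi : IsIso ((projAdj p).unit.app (⊥_ A)) := inferInstance
  obtain ⟨b, φ, hφ⟩ :=
    Functor.IsPreFibered.exists_isCartesian' (p := p) ((projAdj p).unit.app (⊥_ A))
  have h2 : p.IsStronglyCartesian ((projAdj p).unit.app (⊥_ A)) φ := inferInstance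
  have hφi : IsIso φ :=
    Functor.IsStronglyCartesian.isIso_of_base_isIso p ((projAdj p).unit.app (⊥_ A)) φ
  let b' : InitialFibre p := Functor.Fiber.mk (IsHomLift.domain_eq p ((projAdj p).unit.app (⊥_ A)) φ)
  have hb : IsInitial ((fibreIncl p).obj b') :=
    (leftAdjointBotIsInitial p).ofIso (asIso φ).symm
  exact (IsInitial.isInitialOfObj (fibreIncl p) b' hb).hasInitial

theorem fibMonad_bot_isIso_unit (e : InitialFibre p) :
    IsIso ((fibMonad p (⊥_ A)).η.app e) := by
  have h1 : IsIso ((fibreAdj p).unit.app e) := inferInstance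
  have h2 : IsIso (coprod.inr : _ ⟶ sumObj p (⊥_ A) e) := by
    refine ⟨coprod.desc ((leftAdjointBotIsInitial p).to _) (𝟙 _), coprod.inr_desc _ _,
      coprod.hom_ext ((leftAdjointBotIsInitial p).hom_ext _ _) ?_⟩
    rw [← Category.assoc, coprod.inr_desc, Category.id_comp, Category.comp_id]
  exact IsIso.comp_isIso' h1 (Functor.map_isIso _ _)

theorem nonempty_iso_id_of_isIso_unit {X : Type u'} [Category.{v'} X] (T : Monad X)
    (h : ∀ x, IsIso (T.η.app x)) : Nonempty (T ≅ Monad.id X) := by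
  refine ⟨(MonadIso.mk (M := Monad.id X) (N := T) (NatIso.ofComponents (fun x => @asIso _ _ _ _ (T.η.app x) (h x))
    (fun f => T.η.naturality f)) (fun x => ?_) (fun x => ?_)).symm⟩
  · exact Category.id_comp _
  · change 𝟙 _ ≫ T.η.app x = (T.η.app x ≫ T.η.app (T.obj x)) ≫ T.μ.app x
    rw [Category.assoc, T.left_unit, Category.id_comp]
    exact (Category.comp_id _).symm

theorem fibParamMonad_isPruned : IsPrunedMonad (fibParamMonad p) :=
  ⟨hasInitial_initialFibre p, nonempty_iso_id_of_isIso_unit _ (fibMonad_bot_isIso_unit p)⟩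

end PrunedMonad

section PrunedEM

variable {A : Type u} [Category.{v} A] {X : Type u'} [Category.{v'} X] (T : A ⥤ Monad X)

/-- The free algebra of `T_a` on `x`. -/
@[simps]
def freeEM (a : A) (x : X) : EMObj T where
  base := a
  alg :=
    { A := (T.obj a).obj x
      a := (T.obj a).μ.app x
      unit := (T.obj a).left_unit x
      assoc := ((T.obj a).assoc x).symm }

variable {T}

/-- The morphism out of a free algebra induced by a morphism of parameters and a morphism out of
the generating object. -/
@[simps]
def freeEMDesc {a : A} {x : X} {P : EMObj T} (f : a ⟶ P.base) (k : x ⟶ P.alg.A) :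
    freeEM T a x ⟶ P where
  base := f
  carrier := (T.map f).app x ≫ (T.obj P.base).map k ≫ P.alg.a
  comm := by
    change (T.map f).app ((T.obj a).obj x) ≫
      (T.obj P.base).map ((T.map f).app x ≫ (T.obj P.base).map k ≫ P.alg.a) ≫ P.alg.a =
      (T.obj a).μ.app x ≫ (T.map f).app x ≫ (T.obj P.base).map k ≫ P.alg.a
    have h₁ := (T.map f).app_μ x
    have h₂ : (T.obj P.base).map ((T.obj P.base).map k) ≫ (T.obj P.base).μ.app P.alg.A =
      (T.obj P.base).μ.app x ≫ (T.obj P.base).map k := (T.obj P.base).μ.naturality k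
    have h₃ := (T.map f).naturality ((T.map f).app x)
    rw [reassoc_of% h₁, ← reassoc_of% h₂, reassoc_of% h₃, P.alg.assoc]
    simp only [Functor.map_comp, Category.assoc]

theorem freeEM_key {a b : A} {x y : X} (f : a ⟶ b) (ξ : (T.obj b).obj y ⟶ y)
    (c : (T.obj a).obj x ⟶ y)
    (hc : (T.map f).app ((T.obj a).obj x) ≫ (T.obj b).map c ≫ ξ = (T.obj a).μ.app x ≫ c) :
    c = (T.map f).app x ≫ (T.obj b).map ((T.obj a).η.app x ≫ c) ≫ ξ := by
  have hn : (T.obj a).map ((T.obj a).η.app x) ≫ (T.map f).app ((T.obj a).obj x) =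
    (T.map f).app x ≫ (T.obj b).map ((T.obj a).η.app x) :=
    (T.map f).naturality ((T.obj a).η.app x)
  rw [Functor.map_comp, Category.assoc, ← reassoc_of% hn, hc]
  exact ((T.obj a).right_unit_assoc _ c).symm

theorem freeEM_hom_ext {a : A} {x : X} {P : EMObj T} {φ ψ : freeEM T a x ⟶ P}
    (h₁ : φ.base = ψ.base)
    (h₂ : (T.obj a).η.app x ≫ φ.carrier = (T.obj a).η.app x ≫ ψ.carrier) : φ = ψ := by
  refine EMHom.hom_ext h₁ ?_
  exact (freeEM_key φ.base P.alg.a φ.carrier φ.comm).trans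
    ((congrArg₂ (fun (f : a ⟶ P.base) (k : x ⟶ P.alg.A) =>
      (T.map f).app x ≫ (T.obj P.base).map k ≫ P.alg.a) h₁ h₂).trans
    (freeEM_key ψ.base P.alg.a ψ.carrier ψ.comm).symm)

theorem freeEMDesc_unit {a : A} {x : X} {P : EMObj T} (f : a ⟶ P.base) (k : x ⟶ P.alg.A) :
    (T.obj a).η.app x ≫ (freeEMDesc f k).carrier = k := by
  change (T.obj a).η.app x ≫ (T.map f).app x ≫ (T.obj P.base).map k ≫ P.alg.a = k
  have h := (T.map f).app_η x
  have h₂ := (T.obj P.base).η.naturality k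
  rw [reassoc_of% h, ← reassoc_of% h₂, P.alg.unit]
  exact Category.comp_id _

/-- The morphism from a value of a left adjoint of the projection to a free algebra which is the
adjunct of the identity. -/
def emInl {L : A ⥤ EMObj T} (adj : L ⊣ emProj T) (a : A) (x : X) : L.obj a ⟶ freeEM T a x :=
  (adj.homEquiv a (freeEM T a x)).symm (𝟙 a)

theorem homEquiv_emInl {L : A ⥤ EMObj T} (adj : L ⊣ emProj T) (a : A) (x : X) :
    adj.homEquiv a (freeEM T a x) (emInl adj a x) = 𝟙 a :=
  (adj.homEquiv a (freeEM T a x)).apply_symm_apply (𝟙 a)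

theorem homEquiv_emInl_comp {L : A ⥤ EMObj T} (adj : L ⊣ emProj T) (a : A) (x : X) {Q : EMObj T}
    (m : freeEM T a x ⟶ Q) : adj.homEquiv a Q (emInl adj a x ≫ m) = m.base :=
  (adj.homEquiv_naturality_right (emInl adj a x) m).trans
    ((congrArg (fun t : a ⟶ a => t ≫ m.base) (homEquiv_emInl adj a x)).trans
      (Category.id_comp _))

theorem isIso_emInl_base {L : A ⥤ EMObj T} (adj : L ⊣ emProj T) [IsIso adj.unit] (a : A) (x : X) :
    IsIso ((emProj T).map (emInl adj a x)) := by
  have h : adj.unit.app a ≫ (emProj T).map (emInl adj a x) = 𝟙 a :=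
    (adj.homEquiv_unit (f := emInl adj a x)).symm.trans (homEquiv_emInl adj a x)
  have h₂ : IsIso (adj.unit.app a ≫ (emProj T).map (emInl adj a x)) := by
    rw [h]; exact inferInstanceAs (IsIso (𝟙 a))
  exact IsIso.of_isIso_comp_left (adj.unit.app a) _

section

variable [HasInitial X]

/-- The universal property of the free algebra on the initial object. -/
noncomputable def freeEMEquiv (a : A) (P : EMObj T) :
    (freeEM T a (⊥_ X) ⟶ P) ≃ (a ⟶ (emProj T).obj P) where
  toFun := EMHom.base
  invFun := fun f => freeEMDesc f (initial.to _)
  left_inv _ := freeEM_hom_ext rfl (initialIsInitial.hom_ext _ _)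
  right_inv _ := rfl

variable (T) in
/-- The left adjoint of the projection of the Eilenberg–Moore fibration. -/
noncomputable def emFree : A ⥤ EMObj T :=
  Adjunction.leftAdjointOfEquiv (G := emProj T) (F_obj := fun a => freeEM T a (⊥_ X))
    (freeEMEquiv (T := T)) (fun _ _ _ _ _ => rfl)

variable (T) in
/-- The adjunction between the projection of the Eilenberg–Moore fibration and its left
adjoint. -/
noncomputable def emFreeAdj : emFree T ⊣ emProj T :=
  Adjunction.adjunctionOfEquivLeft (G := emProj T) (F_obj := fun a => freeEM T a (⊥_ X))
    (freeEMEquiv (T := T)) (fun _ _ _ _ _ => rfl)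

theorem emFreeAdj_unit_app (a : A) : (emFreeAdj T).unit.app a = 𝟙 a := by
  exact (show _ = freeEMEquiv a _ (𝟙 (freeEM T a (⊥_ X))) by
    simp only [emFreeAdj, Adjunction.adjunctionOfEquivLeft]
    rfl)

instance : IsIso (emFreeAdj T).unit := by
  have (a : A) : IsIso ((emFreeAdj T).unit.app a) := by
    rw [emFreeAdj_unit_app]
    exact inferInstanceAs (IsIso (𝟙 a))
  exact NatIso.isIso_of_isIso_app _

instance : (emProj T).IsRightAdjoint := (emFreeAdj T).isRightAdjoint

end

variable [HasInitial A]

theorem isIso_unit_of_iso_id {M : Monad X} (i : M ≅ Monad.id X) (x : X) :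
    IsIso (M.η.app x) := by
  have h : M.η.app x ≫ i.hom.app x = 𝟙 x := i.hom.app_η x
  have h₂ : i.hom.app x ≫ i.inv.app x = 𝟙 (M.obj x) :=
    congrArg (fun t : M ⟶ M => t.app x) i.hom_inv_id
  have h₃ : i.inv.app x ≫ i.hom.app x = 𝟙 x :=
    congrArg (fun t : Monad.id X ⟶ Monad.id X => t.app x) i.inv_hom_id
  have h₄ : IsIso (i.hom.app x) := ⟨i.inv.app x, h₂, h₃⟩
  have h₅ : IsIso (M.η.app x ≫ i.hom.app x) := by rw [h]; exact inferInstanceAs (IsIso (𝟙 x))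
  exact IsIso.of_isIso_comp_right _ (i.hom.app x)

theorem bot_alg_comm (i : T.obj (⊥_ A) ≅ Monad.id X) (a : A) {b : A} (hb : b = ⊥_ A)
    (f : b ⟶ a) (Q : (T.obj b).Algebra) :
    (T.map f).app Q.A ≫ (T.obj a).map ((T.obj a).η.app Q.A) ≫ (T.obj a).μ.app Q.A =
      Q.a ≫ (T.obj a).η.app Q.A := by
  subst hb
  have hη := isIso_unit_of_iso_id i Q.A
  have h : (T.obj (⊥_ A)).η.app Q.A ≫ (T.map f).app Q.A = (T.obj a).η.app Q.A :=
    (T.map f).app_η Q.A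
  rw [(T.obj a).right_unit, ← cancel_epi ((T.obj (⊥_ A)).η.app Q.A), Q.unit_assoc]
  exact (congrArg _ (Category.comp_id _)).trans h

/-- The cocone exhibiting the free algebra of `T_a` on the carrier of an algebra over `∅` as a
coproduct. -/
noncomputable def emCofan (i : T.obj (⊥_ A) ≅ Monad.id X) {L : A ⥤ EMObj T} (adj : L ⊣ emProj T)
    (a : A) (P : EMObj T) (hP : P.base = ⊥_ A) : BinaryCofan (L.obj a) P :=
  BinaryCofan.mk (P := freeEM T a P.alg.A) (emInl adj a P.alg.A)
    (EMHom.mk (P := P) (Q := freeEM T a P.alg.A) (eqToHom hP ≫ initial.to a)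
      ((T.obj a).η.app P.alg.A) (bot_alg_comm i a hP _ P.alg))

theorem base_hom_ext {P : EMObj T} (hP : P.base = ⊥_ A) {b : A} (f g : P.base ⟶ b) : f = g := by
  have h : IsInitial P.base := initialIsInitial.ofIso (eqToIso hP.symm)
  exact h.hom_ext f g

/-- The cocone `emCofan` is colimiting. -/
noncomputable def emCofanIsColimit (i : T.obj (⊥_ A) ≅ Monad.id X) {L : A ⥤ EMObj T}
    (adj : L ⊣ emProj T) (a : A) (P : EMObj T) (hP : P.base = ⊥_ A) :
    IsColimit (emCofan i adj a P hP) :=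
  BinaryCofan.IsColimit.mk _
    (fun {Q} f g => freeEMDesc (adj.homEquiv a Q f) g.carrier)
    (fun {Q} _ _ => (adj.homEquiv a Q).injective (homEquiv_emInl_comp adj a P.alg.A _))
    (fun {_} _ _ => EMHom.hom_ext (base_hom_ext hP _ _) (freeEMDesc_unit _ _))
    (fun {Q} _ _ m h₁ h₂ => freeEM_hom_ext
      ((homEquiv_emInl_comp adj a P.alg.A m).symm.trans (congrArg (adj.homEquiv a Q) h₁))
      ((congrArg EMHom.carrier h₂).trans (freeEMDesc_unit _ _).symm))

variable [HasInitial X]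

/-- The Eilenberg–Moore fibration of a pruned parametrized monad is pruned. -/
theorem emProj_isPruned (i : T.obj (⊥_ A) ≅ Monad.id X) : IsPruned (emProj T) := by
  have hu : (emProj T).leftAdjoint ≅ emFree T :=
    (Adjunction.ofIsRightAdjoint (emProj T)).leftAdjointUniq (emFreeAdj T)
  let ff := (emFreeAdj T).fullyFaithfulLOfIsIsoUnit
  have h₁ : (emFree T).Full := ff.full
  have h₂ : (emFree T).Faithful := ff.faithful
  have h₃ : (emProj T).leftAdjoint.Full := Functor.Full.of_iso hu.symm
  have h₄ : (emProj T).leftAdjoint.Faithful := Functor.Faithful.of_iso hu.symm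
  have hP (e : InitialFibre (emProj T)) : ((fibreIncl (emProj T)).obj e).base = ⊥_ A := e.2
  refine ⟨inferInstance, h₃, h₄, fun a e => ?_, fun a e => ?_⟩
  · exact ⟨⟨⟨_, emCofanIsColimit i (Adjunction.ofIsRightAdjoint (emProj T)) a _ (hP e)⟩⟩⟩
  · refine preservesColimit_of_preserves_colimit_cocone
      (emCofanIsColimit i (Adjunction.ofIsRightAdjoint (emProj T)) a _ (hP e)) ?_
    refine (isColimitMapCoconeBinaryCofanEquiv _ _ _).symm ?_
    have hI : IsInitial ((emProj T).obj ((fibreIncl (emProj T)).obj e)) :=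
      initialIsInitial.ofIso (eqToIso (hP e).symm)
    exact ((BinaryCofan.isColimit_iff_isIso_inl hI _).2
      (isIso_emInl_base (Adjunction.ofIsRightAdjoint (emProj T)) a _)).some

end PrunedEM

section Adjunction

open Bicategory

/-- A 2-functor between strict 2-categories with prescribed action on objects. -/
structure TwoFunctorOn {B : Type u₁} [Bicategory.{w₁, v₁} B] {C : Type u₂} [Bicategory.{w₂, v₂} C]
    (o : B → C) where
  /-- the action on 1-cells -/
  map : ∀ {a b : B}, (a ⟶ b) → (o a ⟶ o b)
  /-- the action on 2-cells -/
  map₂ : ∀ {a b : B} {f g : a ⟶ b}, (f ⟶ g) → (map f ⟶ map g)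
  map₂_id : ∀ {a b : B} (f : a ⟶ b), map₂ (𝟙 f) = 𝟙 (map f)
  map₂_comp : ∀ {a b : B} {f g h : a ⟶ b} (η : f ⟶ g) (θ : g ⟶ h),
    map₂ (η ≫ θ) = map₂ η ≫ map₂ θ
  map_id : ∀ a : B, map (𝟙 a) = 𝟙 (o a)
  map_comp : ∀ {a b c : B} (f : a ⟶ b) (g : b ⟶ c), map (f ≫ g) = map f ≫ map g
  map₂_whisker_left : ∀ {a b c : B} (f : a ⟶ b) {g g' : b ⟶ c} (η : g ⟶ g'),
    map₂ (f ◁ η) = eqToHom (map_comp f g) ≫ map f ◁ map₂ η ≫ eqToHom (map_comp f g').symm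
  map₂_whisker_right : ∀ {a b c : B} {f f' : a ⟶ b} (η : f ⟶ f') (g : b ⟶ c),
    map₂ (η ▷ g) = eqToHom (map_comp f g) ≫ map₂ η ▷ map g ≫ eqToHom (map_comp f' g).symm

/-- A 2-functor with prescribed action on objects, as a strict pseudofunctor. -/
def TwoFunctorOn.toStrict {B : Type u₁} [Bicategory.{w₁, v₁} B] [Strict B] {C : Type u₂}
    [Bicategory.{w₂, v₂} C] [Strict C] {o : B → C} (F : TwoFunctorOn o) :
    StrictPseudofunctor B C :=
  StrictPseudofunctor.mk''
    { obj := o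
      map := F.map
      map₂ := F.map₂
      map₂_id := F.map₂_id
      map₂_comp := F.map₂_comp
      map_id := F.map_id
      map_comp := F.map_comp
      map₂_whisker_left := F.map₂_whisker_left
      map₂_whisker_right := F.map₂_whisker_right }

/-- The functor `g ↦ R g ∘ η_b` from `C(L b, c)` to `B(b, R c)` induced by a morphism
`η_b : b ⟶ R (L b)`. -/
@[simps]
def transposeFunctor {B : Type u₁} [Bicategory.{w₁, v₁} B] {C : Type u₂}
    [Bicategory.{w₂, v₂} C] (R : Pseudofunctor C B) {b : B} {l : C} (η : b ⟶ R.obj l) (c : C) :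
    (l ⟶ c) ⥤ (b ⟶ R.obj c) where
  obj g := η ≫ R.map g
  map α := η ◁ R.map₂ α
  map_id g := by simp
  map_comp α β := by simp

/-- A 2-dimensional adjunction `L ⊣ R` given by a pseudonatural unit `η` such that `g ↦ R g ∘ η_b`
is an equivalence of categories from `C(L b, c)` to `B(b, R c)`, for all `b` and `c`. -/
structure Biadjunction {B : Type u₁} [Bicategory.{w₁, v₁} B] {C : Type u₂}
    [Bicategory.{w₂, v₂} C] (L : Pseudofunctor B C) (R : Pseudofunctor C B) where
  /-- the unit -/
  unit : Pseudofunctor.StrongTrans (Pseudofunctor.id B) (L.comp R)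
  isEquivalence : ∀ (b : B) (c : C), (transposeFunctor R (unit.app b) c).IsEquivalence

theorem emTwoFunctor_mapComp_hom {A : Type u} [Category.{v} A] {T S R : ParamMonad.{v, v', u, u'} A}
    (F : T ⟶ S) (G : S ⟶ R) :
    ((emTwoFunctor A).mapComp F G).hom = eqToHom ((emTwoFunctor A).map_comp F G) := rfl

theorem emTwoFunctor_mapComp_inv {A : Type u} [Category.{v} A] {T S R : ParamMonad.{v, v', u, u'} A}
    (F : T ⟶ S) (G : S ⟶ R) :
    ((emTwoFunctor A).mapComp F G).inv = eqToHom ((emTwoFunctor A).map_comp F G).symm := rfl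

variable (A : Type u) [Category.{v} A] [HasInitial A]

set_option linter.checkUnivs false in
/-- The 2-category of pruned fibrations over `A`, as a full sub-2-category of the 2-category of
fibrations over `A`. -/
abbrev PrunedFib : Type _ :=
  InducedBicategory (Fib.{v, v', u, u'} A)
    (fun p : {p : Fib.{v, v', u, u'} A // IsPruned p.proj} => p.1)

set_option linter.checkUnivs false in
/-- The 2-category of pruned parametrized monads over `A`, as a full sub-2-category of the
2-category of parametrized monads over `A`. -/
abbrev PrunedParamMonad : Type _ :=
  InducedBicategory (ParamMonad.{v, v', u, u'} A)
    (fun T : {T : ParamMonad.{v, v', u, u'} A // IsPrunedMonad T.T} => T.1)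

variable {A}

/-- The fibration underlying a pruned fibration. -/
abbrev PrunedFib.fib (p : PrunedFib.{v, v', u, u'} A) : Fib.{v, v', u, u'} A := p.1

instance (p : PrunedFib.{v, v', u, u'} A) : IsPruned p.fib.proj := p.2

/-- The parametrized monad underlying a pruned parametrized monad. -/
abbrev PrunedParamMonad.mnd (T : PrunedParamMonad.{v, v', u, u'} A) :
    ParamMonad.{v, v', u, u'} A := T.1

/-- The pruned parametrized monad `T^p` of a pruned fibration `p`. -/
noncomputable def fibToMonad (p : PrunedFib.{v, v', u, u'} A) : PrunedParamMonad.{v, v', u, u'} A :=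
  ⟨{ Carrier := InitialFibre p.fib.proj, T := fibParamMonad p.fib.proj },
    fibParamMonad_isPruned p.fib.proj⟩

/-- The pruned Eilenberg–Moore fibration `p^T` of a pruned parametrized monad `T`. -/
def monadToFib (T : PrunedParamMonad.{v, v', u, u'} A) :
    PrunedFib.{v, max v v', u, max u u' v'} A :=
  ⟨emFib T.mnd, by
    obtain ⟨h, ⟨i⟩⟩ := T.2
    exact emProj_isPruned i⟩

theorem prunedFib_eqToHom {p q : PrunedFib.{v, v', u, u'} A} {f g : p.fib ⟶ q.fib} (h : f = g)
    (h' : (InducedBicategory.mkHom f : p ⟶ q) = InducedBicategory.mkHom g) :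
    eqToHom h = (eqToHom h').hom := by
  subst h; rfl

variable (A) in
/-- The 2-functor sending a pruned parametrized monad to its Eilenberg–Moore fibration. -/
def emPrunedTwoFunctor : StrictPseudofunctor (PrunedParamMonad.{v, v', u, u'} A)
    (PrunedFib.{v, max v v', u, max u u' v'} A) :=
  StrictPseudofunctor.mk''
    { obj := fun T => monadToFib T
      map := fun F => InducedBicategory.mkHom (emMap F.hom)
      map₂ := fun α => InducedBicategory.Hom₂.mk (emMap₂ α.hom)
      map₂_id := fun f => InducedBicategory.hom₂_ext ((emTwoFunctor A).map₂_id f.hom)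
      map₂_comp := fun α β => InducedBicategory.hom₂_ext ((emTwoFunctor A).map₂_comp α.hom β.hom)
      map_id := fun T => InducedBicategory.hom_ext (emMap_id T.mnd)
      map_comp := fun F G => InducedBicategory.hom_ext (emMap_comp F.hom G.hom)
      map₂_whisker_left := fun {T _ U} F _ _ α => InducedBicategory.hom₂_ext
        (((emTwoFunctor A).map₂_whisker_left F.hom α.hom).trans
          (congrArg₂ (fun s t => s ≫ ((emTwoFunctor A).map F.hom ◁ (emTwoFunctor A).map₂ α.hom) ≫ t)
            ((emTwoFunctor_mapComp_hom _ _).trans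
              (prunedFib_eqToHom (p := monadToFib T) (q := monadToFib U) _ _))
            ((emTwoFunctor_mapComp_inv _ _).trans
              (prunedFib_eqToHom (p := monadToFib T) (q := monadToFib U) _ _))))
      map₂_whisker_right := fun {T _ U _ _} α H => InducedBicategory.hom₂_ext
        (((emTwoFunctor A).map₂_whisker_right α.hom H.hom).trans
          (congrArg₂ (fun s t => s ≫ ((emTwoFunctor A).map₂ α.hom ▷ (emTwoFunctor A).map H.hom) ≫ t)
            ((emTwoFunctor_mapComp_hom _ _).trans
              (prunedFib_eqToHom (p := monadToFib T) (q := monadToFib U) _ _))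
            ((emTwoFunctor_mapComp_inv _ _).trans
              (prunedFib_eqToHom (p := monadToFib T) (q := monadToFib U) _ _)))) }

end Adjunction

end FibMon

open FibMon

/-! Two universal properties are matched. A map `p_L a + i e ⟶ x` is a pair of maps `a ⟶ p x` and `e
⟶ i_R x`. A map from the free `T_a`-algebra on `x` to an algebra `(b, y, ξ)` is a pair `f : a ⟶ b`,
`k : x ⟶ y`, and its carrier is `algExtend T f k ξ`. For the algebra that the comparison functor
puts on `i_R x`, the second extension is `i_R` of the first copairing (`algExtend_sumCounit`).

The common tool is `FibredLift`: a functor `G` to the algebras of `S`, with a natural base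
comparison `b` and carriers isomorphic to `V i_R` through `κ`. It forces a cell `S_a V e ⟶ V T^p_a
e`: extend the image of the unit of `T^p_a` to the free `S_a`-algebra, with values in the algebra `G
(p_L a + i e)`, and come back along `κ`. The axioms of a morphism of parametrized monads become
equalities between extensions, and `(b, κ)` is itself a map of algebras from the induced functor
after the comparison to `G`. Using `b` instead of an equality of base objects avoids transport.

Three kinds of lift are used. A fibred functor `H` followed by the comparison of its target gives
the value of `L` at `H` and the pseudonaturality square. An arbitrary fibred functor into `p^S`
gives essential surjectivity of transposition; there `κ` is invertible because the counit of `i ⊣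
i_R` is cartesian. The transpose of a morphism `K` gives `K` back (`homLift_delta`), whence
fullness. Faithfulness holds because every object of the initial fibre is isomorphic to some `i_R
x`.

For the recognition statement, let `G : p ⟶ p^S` be an equivalence with `S_∅` trivial. The induced
morphism `K` of parametrized monads has a fully faithful underlying functor, since maps out of
algebras over `∅` are just maps of carriers, and invertible cells, since `G` sends `p_L a + i e` to
a free algebra. So `R K` is fully faithful. As `R K ∘ η_p ≅ G`, it is also essentially surjective,
and `η_p` is an equivalence by cancellation. Conversely, a fibred functor that is an equivalence of
categories has a fibred quasi-inverse (`nonempty_equivalence_of_isEquivalence`). -/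

namespace FibMon

/-! ### Calculus of extensions to free algebras. -/

section Extension

variable {A : Type u} [Category.{v} A] {X : Type u'} [Category.{v'} X] (T : A ⥤ Monad X)

/-- The extension of `k : x ⟶ y` to `T_a x` along `f : a ⟶ b` and a structure map on `y`. -/
def algExtend {a b : A} {x y : X} (f : a ⟶ b) (k : x ⟶ y) (ξ : (T.obj b).obj y ⟶ y) :
    (T.obj a).obj x ⟶ y :=
  (T.map f).app x ≫ (T.obj b).map k ≫ ξ

variable {T}

theorem map_algExtend {a b : A} {x x' y : X} (f : a ⟶ b) (g : x' ⟶ x) (k : x ⟶ y)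
    (ξ : (T.obj b).obj y ⟶ y) :
    (T.obj a).map g ≫ algExtend T f k ξ = algExtend T f (g ≫ k) ξ := by
  have h := (T.map f).naturality g
  dsimp only [algExtend]
  rw [reassoc_of% h, Functor.map_comp, Category.assoc]

theorem param_algExtend {a b c : A} {x y : X} (h : c ⟶ a) (f : a ⟶ b) (k : x ⟶ y)
    (ξ : (T.obj b).obj y ⟶ y) :
    (T.map h).app x ≫ algExtend T f k ξ = algExtend T (h ≫ f) k ξ := by
  dsimp only [algExtend]
  rw [T.map_comp, ← Category.assoc]
  rfl

/-- Algebra morphisms preserve extensions, because an extension is the carrier of a map out of a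
free algebra. With the two precomposition rules above, this moves every map in a composite into the
arguments of `algExtend`. -/
theorem algExtend_comp_carrier {a : A} {x : X} {P Q : EMObj T} (f : a ⟶ P.base) (k : x ⟶ P.alg.A)
    (φ : P ⟶ Q) : algExtend T f k P.alg.a ≫ φ.carrier =
      algExtend T (f ≫ φ.base) (k ≫ φ.carrier) Q.alg.a := by
  rw [← param_algExtend]
  dsimp only [algExtend]
  have h := (T.map φ.base).naturality k
  rw [Functor.map_comp, Category.assoc, Category.assoc, Category.assoc, ← reassoc_of% h, ← φ.comm]

theorem unit_algExtend {a : A} {x : X} {P : EMObj T} (f : a ⟶ P.base) (k : x ⟶ P.alg.A) :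
    (T.obj a).η.app x ≫ algExtend T f k P.alg.a = k :=
  freeEMDesc_unit f k

/-- The multiplication is the structure map of the free algebra, so this is the algebra-morphism law
of `freeEMDesc`. -/
theorem mul_algExtend {a : A} {x : X} {P : EMObj T} (f : a ⟶ P.base) (k : x ⟶ P.alg.A) :
    (T.obj a).μ.app x ≫ algExtend T f k P.alg.a =
      algExtend T f (algExtend T f k P.alg.a) P.alg.a :=
  (freeEMDesc (P := P) f k).comm.symm

theorem algExtend_id {P : EMObj T} :
    algExtend T (𝟙 P.base) (𝟙 P.alg.A) P.alg.a = P.alg.a := by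
  simp [algExtend]

end Extension

section Corefl

variable {A : Type u} [Category.{v} A] [HasInitial A] {E : Type u'} [Category.{v'} E]
  {p : E ⥤ A} [p.IsFibered]

theorem homEquiv_counit (x : E) :
    (fibreAdj p).homEquiv _ x ((fibreAdj p).counit.app x) = 𝟙 ((fibreCorefl p).obj x) := by
  rw [Adjunction.homEquiv_unit]
  exact (fibreAdj p).right_triangle_components x

end Corefl

/-! ### Components of maps out of `p_L a + i e`, and the monad `T^p`. -/

section Sum

variable {A : Type u} [Category.{v} A] [HasInitial A] {E : Type u'} [Category.{v'} E]
  (p : E ⥤ A) [IsPruned p]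

/-- The canonical morphism `a ⟶ p (p_L a + i e)`. -/
noncomputable def sumBase (a : A) (e : InitialFibre p) : a ⟶ p.obj (sumObj p a e) :=
  (projAdj p).unit.app a ≫ p.map coprod.inl

variable {p}

/-- The morphism out of `p_L a + i e` induced by `a ⟶ p x` and `i e ⟶ x`. -/
noncomputable def sumDesc {a : A} {e : InitialFibre p} {x : E} (f : a ⟶ p.obj x)
    (k : (fibreIncl p).obj e ⟶ x) : sumObj p a e ⟶ x :=
  coprod.desc (((projAdj p).homEquiv a x).symm f) k

theorem inr_sumDesc {a : A} {e : InitialFibre p} {x : E} (f : a ⟶ p.obj x)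
    (k : (fibreIncl p).obj e ⟶ x) : coprod.inr ≫ sumDesc f k = k :=
  coprod.inr_desc _ _

theorem sumBase_comp_map {a : A} {e : InitialFibre p} {x : E} (m : sumObj p a e ⟶ x) :
    sumBase p a e ≫ p.map m = (projAdj p).homEquiv a x (coprod.inl ≫ m) := by
  rw [Adjunction.homEquiv_unit, sumBase, Category.assoc, p.map_comp]

theorem sumBase_sumDesc {a : A} {e : InitialFibre p} {x : E} (f : a ⟶ p.obj x)
    (k : (fibreIncl p).obj e ⟶ x) : sumBase p a e ≫ p.map (sumDesc f k) = f := by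
  rw [sumBase_comp_map, sumDesc, coprod.inl_desc, Equiv.apply_symm_apply]

/-- The first component is tested in the base, as its adjunct under `p_L ⊣ p`, so that `p_L` never
has to be compared across different fibrations. -/
theorem sum_hom_ext {a : A} {e : InitialFibre p} {x : E} {m n : sumObj p a e ⟶ x}
    (h₁ : sumBase p a e ≫ p.map m = sumBase p a e ≫ p.map n)
    (h₂ : coprod.inr ≫ m = coprod.inr ≫ n) : m = n := by
  rw [sumBase_comp_map, sumBase_comp_map] at h₁
  exact coprod.hom_ext (((projAdj p).homEquiv a x).injective h₁) h₂

theorem sumBase_map_left {a b : A} (f : a ⟶ b) (e : InitialFibre p) :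
    sumBase p a e ≫ p.map (coprod.map (p.leftAdjoint.map f) (𝟙 _)) = f ≫ sumBase p b e := by
  have h : f ≫ (projAdj p).unit.app b = (projAdj p).unit.app a ≫ p.map (p.leftAdjoint.map f) :=
    (projAdj p).unit.naturality f
  rw [sumBase_comp_map, coprod.inl_map, Adjunction.homEquiv_unit, sumBase, p.map_comp,
    reassoc_of% h]

theorem sumBase_map_right (a : A) {e e' : InitialFibre p} (g : e ⟶ e') :
    sumBase p a e ≫ p.map (coprod.map (𝟙 _) ((fibreIncl p).map g)) = sumBase p a e' := by
  rw [sumBase_comp_map, coprod.inl_map, Adjunction.homEquiv_unit, sumBase, Category.id_comp]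

variable [p.IsFibered]

theorem sumBase_sumMul (a : A) (e : InitialFibre p) :
    sumBase p a _ ≫ p.map (sumMul p a e) = sumBase p a e := by
  rw [sumBase_comp_map, coprod.inl_desc, Adjunction.homEquiv_unit, sumBase]

theorem sumBase_sumCounit (x : E) :
    sumBase p _ _ ≫ p.map (sumCounit p x) = 𝟙 (p.obj x) := by
  rw [sumBase_comp_map, coprod.inl_desc, Adjunction.homEquiv_unit]
  exact (projAdj p).right_triangle_components x

variable (p) in
/-- The unit of the monad `T^p_a`. -/
noncomputable def sumUnit (a : A) (e : InitialFibre p) :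
    e ⟶ (fibreCorefl p).obj (sumObj p a e) :=
  (fibreAdj p).homEquiv e _ coprod.inr

theorem fibMonad_unit_app (a : A) (e : InitialFibre p) :
    (fibMonad p a).η.app e = sumUnit p a e :=
  ((fibreAdj p).homEquiv_unit _ _ _).symm

/-- The counterpart of `sumBase_comp_map` for the second component. Together the two reduce
`coprod.map`, `sumMul` and `sumCounit` to the data from which `algExtend` is built. -/
theorem sumUnit_comp {a : A} {e : InitialFibre p} {x : E} (m : sumObj p a e ⟶ x) :
    sumUnit p a e ≫ (fibreCorefl p).map m = (fibreAdj p).homEquiv e x (coprod.inr ≫ m) :=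
  ((fibreAdj p).homEquiv_naturality_right _ _).symm

theorem sumUnit_map_left {a b : A} (f : a ⟶ b) (e : InitialFibre p) :
    sumUnit p a e ≫ (fibreCorefl p).map (coprod.map (p.leftAdjoint.map f) (𝟙 _)) =
      sumUnit p b e := by
  rw [sumUnit_comp, coprod.inr_map, Category.id_comp, sumUnit]

theorem sumUnit_map_right (a : A) {e e' : InitialFibre p} (g : e ⟶ e') :
    sumUnit p a e ≫ (fibreCorefl p).map (coprod.map (𝟙 _) ((fibreIncl p).map g)) =
      g ≫ sumUnit p a e' := by
  rw [sumUnit_comp, coprod.inr_map, sumUnit, Adjunction.homEquiv_naturality_left]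

theorem sumUnit_sumMul (a : A) (e : InitialFibre p) :
    sumUnit p a _ ≫ (fibreCorefl p).map (sumMul p a e) = 𝟙 _ := by
  rw [sumUnit_comp, coprod.inr_desc, homEquiv_counit]

theorem sumUnit_sumCounit (x : E) :
    sumUnit p _ _ ≫ (fibreCorefl p).map (sumCounit p x) = 𝟙 _ := by
  rw [sumUnit_comp, coprod.inr_desc, homEquiv_counit]

/-- This is the bridge between free algebras and coproducts: the factors of the extension are all
values of `i_R`, and their composite is a map out of a coproduct with the two prescribed components.
-/
theorem algExtend_sumCounit {a : A} {e : InitialFibre p} {x : E} (f : a ⟶ p.obj x)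
    (k : e ⟶ (fibreCorefl p).obj x) :
    algExtend (fibParamMonad p) f k ((fibreCorefl p).map (sumCounit p x)) =
      (fibreCorefl p).map (sumDesc f (((fibreAdj p).homEquiv e x).symm k)) := by
  have h : coprod.map (p.leftAdjoint.map f) (𝟙 ((fibreIncl p).obj e)) ≫
      coprod.map (𝟙 (p.leftAdjoint.obj (p.obj x))) ((fibreIncl p).map k) ≫ sumCounit p x =
      sumDesc f (((fibreAdj p).homEquiv e x).symm k) := by
    refine coprod.hom_ext ?_ ?_
    · rw [coprod.inl_map_assoc, coprod.inl_map_assoc, Category.id_comp, coprod.inl_desc, sumDesc,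
        coprod.inl_desc, Adjunction.homEquiv_counit]
    · rw [coprod.inr_map_assoc, Category.id_comp, coprod.inr_map_assoc, coprod.inr_desc, sumDesc,
        coprod.inr_desc, Adjunction.homEquiv_counit]
  rw [← h, Functor.map_comp, Functor.map_comp]
  rfl

end Sum

/-! ### From lifts to morphisms of parametrized monads. -/

section Lift

variable {A : Type u} [Category.{v} A] [HasInitial A] {E : Type u'} [Category.{v'} E]

/-- The parametrized monad of a pruned fibration, with its category of carriers. -/
noncomputable abbrev initialFibreMonad (p : E ⥤ A) [p.IsFibered] [IsPruned p] :
    ParamMonad.{v, v', u, u'} A where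
  Carrier := InitialFibre p
  T := fibParamMonad p

/-- A functor `G` from the total category of `p` to the Eilenberg–Moore category of `S`, lying
over the base up to a comparison `b`, whose carrier is `V i_R` up to an isomorphism `κ`. -/
structure FibredLift (p : E ⥤ A) [p.IsFibered] (S : ParamMonad.{v, v', u, u'} A) where
  /-- the functor to the algebras -/
  G : E ⥤ EMObj S.T
  /-- the functor between the carriers -/
  V : InitialFibre p ⥤ S.Carrier
  /-- the comparison of the base objects -/
  b : ∀ x : E, p.obj x ⟶ (G.obj x).base
  b_naturality : ∀ {x y : E} (m : x ⟶ y), p.map m ≫ b y = b x ≫ (G.map m).base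
  /-- the comparison of the carriers -/
  κ : ∀ x : E, V.obj ((fibreCorefl p).obj x) ⟶ (G.obj x).alg.A
  κ_naturality : ∀ {x y : E} (m : x ⟶ y),
    V.map ((fibreCorefl p).map m) ≫ κ y = κ x ≫ (G.map m).carrier
  isIso_κ : ∀ x : E, IsIso (κ x)

attribute [instance] FibredLift.isIso_κ

namespace FibredLift

variable {p : E ⥤ A} [p.IsFibered] [IsPruned p] {S : ParamMonad.{v, v', u, u'} A}
  (l : FibredLift p S)

/-- The comparison cell of the morphism of parametrized monads induced by a lift. -/
noncomputable def delta (a : A) (e : InitialFibre p) :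
    (S.T.obj a).obj (l.V.obj e) ⟶ l.V.obj ((fibreCorefl p).obj (sumObj p a e)) :=
  algExtend S.T (sumBase p a e ≫ l.b _) (l.V.map (sumUnit p a e) ≫ l.κ _)
    (l.G.obj (sumObj p a e)).alg.a ≫ inv (l.κ _)

/-- As `κ` is invertible, this equation characterises `delta`. The identities below are obtained by
cancelling `κ` and computing with extensions. -/
theorem delta_kappa (a : A) (e : InitialFibre p) :
    l.delta a e ≫ l.κ (sumObj p a e) =
      algExtend S.T (sumBase p a e ≫ l.b _) (l.V.map (sumUnit p a e) ≫ l.κ _)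
        (l.G.obj (sumObj p a e)).alg.a := by
  rw [delta, Category.assoc, IsIso.inv_hom_id, Category.comp_id]

/-- Naturality of `κ` turns `m` into the algebra morphism `G m`, which the extension absorbs. Only
the base and unit components of `m` survive. -/
theorem delta_map_kappa {a : A} {e : InitialFibre p} {x : E} (m : sumObj p a e ⟶ x) :
    l.delta a e ≫ l.V.map ((fibreCorefl p).map m) ≫ l.κ x =
      algExtend S.T ((sumBase p a e ≫ p.map m) ≫ l.b x)
        (l.V.map (sumUnit p a e ≫ (fibreCorefl p).map m) ≫ l.κ x) (l.G.obj x).alg.a := by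
  rw [l.κ_naturality, ← Category.assoc, delta_kappa, algExtend_comp_carrier, Category.assoc,
    Category.assoc, Category.assoc, l.b_naturality, Functor.map_comp, Category.assoc,
    l.κ_naturality]

theorem delta_naturality_carrier (a : A) {e e' : InitialFibre p} (g : e ⟶ e') :
    (S.T.obj a).map (l.V.map g) ≫ l.delta a e' =
      l.delta a e ≫
        l.V.map ((fibreCorefl p).map (coprod.map (𝟙 _) ((fibreIncl p).map g))) := by
  rw [← cancel_mono (l.κ _), Category.assoc, Category.assoc, delta_map_kappa, delta_kappa,
    map_algExtend, sumBase_map_right, sumUnit_map_right, Functor.map_comp, Category.assoc]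

theorem delta_naturality_param {a b : A} (f : a ⟶ b) (e : InitialFibre p) :
    (S.T.map f).app (l.V.obj e) ≫ l.delta b e =
      l.delta a e ≫
        l.V.map ((fibreCorefl p).map (coprod.map (p.leftAdjoint.map f) (𝟙 _))) := by
  rw [← cancel_mono (l.κ _), Category.assoc, Category.assoc, delta_map_kappa, delta_kappa,
    param_algExtend, sumBase_map_left, sumUnit_map_left, Category.assoc]

theorem unit_delta (a : A) (e : InitialFibre p) :
    (S.T.obj a).η.app (l.V.obj e) ≫ l.delta a e = l.V.map (sumUnit p a e) := by
  rw [← cancel_mono (l.κ _)]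
  refine (Category.assoc _ _ _).trans ?_
  rw [delta_kappa]
  exact unit_algExtend _ _

/-- `sumMul` keeps the base component and restricts to the identity along the unit, so the right
side is an extension of an extension and `mul_algExtend` applies. -/
theorem mul_delta (a : A) (e : InitialFibre p) :
    (S.T.obj a).μ.app (l.V.obj e) ≫ l.delta a e =
      (S.T.obj a).map (l.delta a e) ≫ l.delta a _ ≫
        l.V.map ((fibreCorefl p).map (sumMul p a e)) := by
  rw [← cancel_mono (l.κ _)]
  refine (Category.assoc _ _ _).trans ?_
  rw [Category.assoc, Category.assoc, delta_map_kappa, delta_kappa, map_algExtend,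
    sumBase_sumMul, sumUnit_sumMul, l.V.map_id, Category.id_comp, delta_kappa]
  exact mul_algExtend _ _

/-- The morphism of parametrized monads induced by a lift. -/
noncomputable def toHom : ParamMonadHom (initialFibreMonad p) S where
  V := l.V
  δ a e := l.delta a e
  naturality_carrier a _ _ g := l.delta_naturality_carrier a g
  naturality_param f e := l.delta_naturality_param f e
  unit a e := (l.unit_delta a e).trans (congrArg l.V.map (fibMonad_unit_app a e).symm)
  mul a e := l.mul_delta a e

/-- Each component of `σ` is an algebra morphism, so after cancelling `κ` both sides extend the same
data. The law stands apart from `toHom₂` so that it can also be applied to `homLift`. -/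
theorem delta_comm {l l' : FibredLift p S} (σ : l.G ⟶ l'.G) (ν : l.V ⟶ l'.V)
    (hb : ∀ x, l.b x ≫ (σ.app x).base = l'.b x)
    (hκ : ∀ x, l.κ x ≫ (σ.app x).carrier = ν.app ((fibreCorefl p).obj x) ≫ l'.κ x)
    (a : A) (e : InitialFibre p) :
    (S.T.obj a).map (ν.app e) ≫ l'.delta a e = l.delta a e ≫ ν.app _ := by
  rw [← cancel_mono (l'.κ _), Category.assoc, Category.assoc, ← hκ, delta_kappa, map_algExtend,
    ← Category.assoc (l.delta a e), delta_kappa, algExtend_comp_carrier, Category.assoc,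
    Category.assoc, hb, hκ, ν.naturality_assoc]

/-- A morphism of lifts induces a 2-cell. -/
noncomputable def toHom₂ {l l' : FibredLift p S} (σ : l.G ⟶ l'.G) (ν : l.V ⟶ l'.V)
    (hb : ∀ x, l.b x ≫ (σ.app x).base = l'.b x)
    (hκ : ∀ x, l.κ x ≫ (σ.app x).carrier = ν.app ((fibreCorefl p).obj x) ≫ l'.κ x) :
    l.toHom ⟶ l'.toHom where
  ν := ν
  comm a e := delta_comm σ ν hb hκ a e

/-- The structure map of the algebra of `x`, transported to `V (i_R x)`. -/
theorem delta_sumCounit (x : E) :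
    l.delta (p.obj x) ((fibreCorefl p).obj x) ≫
        l.V.map ((fibreCorefl p).map (sumCounit p x)) ≫ l.κ x =
      algExtend S.T (l.b x) (l.κ x) (l.G.obj x).alg.a := by
  rw [delta_map_kappa, sumBase_sumCounit, sumUnit_sumCounit, l.V.map_id, Category.id_comp,
    Category.id_comp]

/-- The canonical morphism from the algebra induced by the morphism of a lift. -/
noncomputable def counit (x : E) :
    (emMapFunctor l.toHom).obj ((comparison p).obj x) ⟶ l.G.obj x where
  base := l.b x
  carrier := l.κ x
  comm := (l.delta_sumCounit x).symm.trans (Category.assoc _ _ _).symm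

end FibredLift

end Lift

/-! ### Cartesian morphisms and the coreflection `i_R`. -/

section Cartesian

variable {A : Type u} [Category.{v} A] [HasInitial A] {E : Type u'} [Category.{v'} E]
  (p : E ⥤ A)

theorem isHomLift_of_initialFibre {a : A} (e : InitialFibre p) {x : E}
    (k : (fibreIncl p).obj e ⟶ x) (hx : p.obj x = a) : p.IsHomLift (initial.to a) k :=
  IsHomLift.of_fac p _ _ e.2 hx (Subsingleton.elim _ _)

variable [p.IsFibered]

/-- The counit of `i ⊣ i_R` is cartesian. -/
theorem isCartesian_fibreAdj_counit (x : E) :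
    p.IsCartesian (initial.to (p.obj x)) ((fibreAdj p).counit.app x) := by
  have hl := isHomLift_of_initialFibre p ((fibreCorefl p).obj x)
    ((fibreAdj p).counit.app x) rfl
  refine { toIsHomLift := hl, universal_property := fun {z} φ hφ => ?_ }
  have hz : p.obj z = ⊥_ A := IsHomLift.domain_eq p (initial.to (p.obj x)) φ
  let e : InitialFibre p := Functor.Fiber.mk hz
  let k : (fibreIncl p).obj e ⟶ x := φ
  -- The source of a competing lift lies over `∅`, so the lift factors uniquely through the counit
  -- by adjunction; maps between objects of this fibre are automatically vertical.
  let g : e ⟶ (fibreCorefl p).obj x := (fibreAdj p).homEquiv e x k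
  refine ⟨(fibreIncl p).map g, ⟨g.2, ?_⟩, ?_⟩
  · exact ((fibreAdj p).homEquiv_counit e x g).symm.trans
      (((fibreAdj p).homEquiv e x).symm_apply_apply k)
  · rintro χ ⟨hχ, hc⟩
    let g' : e ⟶ (fibreCorefl p).obj x := ⟨χ, hχ⟩
    have h : g' = g := by
      refine ((fibreAdj p).homEquiv e x).symm.injective ?_
      refine Eq.trans ?_ (((fibreAdj p).homEquiv e x).symm_apply_apply k).symm
      exact ((fibreAdj p).homEquiv_counit e x g').trans hc
    exact congrArg Subtype.val h

-- Both maps cover the only map out of `∅`, so the uniqueness clause for strongly cartesian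
-- morphisms applies.
variable {p} in
theorem comp_cartesian_injective {a b : A} (f : a ⟶ b) {x y : E} (φ : x ⟶ y)
    [p.IsCartesian f φ] {e : InitialFibre p} {k k' : (fibreIncl p).obj e ⟶ x}
    (h : k ≫ φ = k' ≫ φ) : k = k' := by
  have hx : p.obj x = a := IsHomLift.domain_eq p f φ
  have h₁ := isHomLift_of_initialFibre p e k hx
  have h₂ := isHomLift_of_initialFibre p e k' hx
  exact Functor.IsStronglyCartesian.ext p f φ (initial.to a) h

/-- The right adjoint `i_R` inverts cartesian morphisms. -/
theorem isIso_fibreCorefl_map {a b : A} (f : a ⟶ b) {x y : E} (φ : x ⟶ y)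
    (h : p.IsCartesian f φ) : IsIso ((fibreCorefl p).map φ) := by
  have hl := isHomLift_of_initialFibre p ((fibreCorefl p).obj y)
    ((fibreAdj p).counit.app y) (IsHomLift.codomain_eq p f φ)
  -- The counit at `y` factors through `φ` because the map from `∅` to the base of `y` factors
  -- through `f`. The adjunct of this factorisation is the required inverse.
  let ψ : (fibreIncl p).obj ((fibreCorefl p).obj y) ⟶ x :=
    Functor.IsStronglyCartesian.map p f φ (g := initial.to a) (f' := initial.to b)
      (Subsingleton.elim _ _) ((fibreAdj p).counit.app y)
  have hψ : ψ ≫ φ = (fibreAdj p).counit.app y :=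
    Functor.IsStronglyCartesian.fac p f φ (g := initial.to a) (f' := initial.to b)
      (Subsingleton.elim _ _) ((fibreAdj p).counit.app y)
  have h₁ : (fibreAdj p).homEquiv _ _ ψ ≫ (fibreCorefl p).map φ = 𝟙 _ := by
    rw [← Adjunction.homEquiv_naturality_right, hψ, homEquiv_counit]
  refine ⟨(fibreAdj p).homEquiv _ _ ψ, ?_, h₁⟩
  refine ((fibreAdj p).homEquiv _ _).symm.injective ?_
  refine comp_cartesian_injective f φ ?_
  rw [← Adjunction.homEquiv_naturality_right_symm, ← Adjunction.homEquiv_naturality_right_symm,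
    Category.assoc, h₁, Category.comp_id, Category.id_comp]

/-- The comparison functor preserves cartesian morphisms. -/
theorem comparison_isCartesian [IsPruned p] {a b : A} (f : a ⟶ b) {x y : E} (φ : x ⟶ y)
    (h : p.IsCartesian f φ) :
    (emProj (fibParamMonad p)).IsCartesian f ((comparison p).map φ) := by
  have hi := isIso_fibreCorefl_map p f φ h
  subst_hom_lift p f φ
  have : IsIso ((comparison p).map φ).carrier := hi
  have h₁ := emProj_isStronglyCartesian ((comparison p).map φ)
  exact @Functor.IsStronglyCartesian.isCartesian_of_isStronglyCartesian _ _ _ _ _ _ _ _ _ _ _ h₁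

end Cartesian

/-! ### Restriction of fibred functors to the initial fibres. -/

section Base

variable {A : Type u} [Category.{v} A] {p q r : Fib.{v, v', u, u'} A}

/-- The base objects of `x` and `H x` agree. -/
noncomputable def resBase (H : FibFunctor p q) (x : p.Total) :
    p.proj.obj x ⟶ q.proj.obj (H.toFunctor.obj x) :=
  eqToHom (H.toBasedFunctor.w_obj x).symm

instance isIso_resBase (H : FibFunctor p q) (x : p.Total) : IsIso (resBase H x) :=
  inferInstanceAs (IsIso (eqToHom _))

theorem resBase_naturality (H : FibFunctor p q) {x y : p.Total} (m : x ⟶ y) :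
    p.proj.map m ≫ resBase H y = resBase H x ≫ q.proj.map (H.toFunctor.map m) := by
  have h := Functor.congr_hom H.toBasedFunctor.w m
  rw [Functor.comp_map] at h
  rw [resBase, resBase, h]
  simp

theorem resBase_comp (H : FibFunctor p q) (K : FibFunctor q r) (x : p.Total) :
    resBase (H.comp K) x = resBase H x ≫ resBase K (H.toFunctor.obj x) :=
  (eqToHom_trans _ _).symm

theorem resBase_trans {H K : FibFunctor p q} (τ : H ⟶ K) (x : p.Total) :
    resBase H x ≫ q.proj.map (τ.nat.app x) = resBase K x := by
  have h := τ.vertical x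
  rw [resBase, resBase, IsHomLift.fac' q.proj (𝟙 (p.proj.obj x)) (τ.nat.app x)]
  simp

end Base

section Restriction

variable {A : Type u} [Category.{v} A] [HasInitial A] {p q r : Fib.{v, v', u, u'} A}

/-- The restriction of a fibred functor to the initial fibres. -/
noncomputable def resFibre (H : FibFunctor p q) :
    InitialFibre p.proj ⥤ InitialFibre q.proj where
  obj e := ⟨H.toFunctor.obj e.1, (H.toBasedFunctor.w_obj e.1).trans e.2⟩
  map g := ⟨H.toFunctor.map g.1, by
    have := g.2
    exact H.toBasedFunctor.preserves_isHomLift _ _⟩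
  map_id e := Subtype.ext (H.toFunctor.map_id e.1)
  map_comp g h := Subtype.ext (H.toFunctor.map_comp g.1 h.1)

/-- The value of `H` at the counit of `i ⊣ i_R`. -/
noncomputable def resCounit (H : FibFunctor p q) (x : p.Total) :
    (fibreIncl q.proj).obj ((resFibre H).obj ((fibreCorefl p.proj).obj x)) ⟶
      H.toFunctor.obj x :=
  H.toFunctor.map ((fibreAdj p.proj).counit.app x)

theorem isCartesian_resCounit (H : FibFunctor p q) (x : p.Total) :
    q.proj.IsCartesian (initial.to (p.proj.obj x)) (resCounit H x) :=
  H.preserves_cartesian _ _ (isCartesian_fibreAdj_counit p.proj x)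

theorem map_resCounit (H : FibFunctor p q) {e : InitialFibre p.proj} {x : p.Total}
    (k : e ⟶ (fibreCorefl p.proj).obj x) :
    (fibreIncl q.proj).map ((resFibre H).map k) ≫ resCounit H x =
      H.toFunctor.map (((fibreAdj p.proj).homEquiv e x).symm k) := by
  rw [Adjunction.homEquiv_counit]
  exact (H.toFunctor.map_comp _ _).symm

theorem resCounit_naturality (H : FibFunctor p q) {x y : p.Total} (m : x ⟶ y) :
    (fibreIncl q.proj).map ((resFibre H).map ((fibreCorefl p.proj).map m)) ≫ resCounit H y =
      resCounit H x ≫ H.toFunctor.map m := by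
  refine ((H.toFunctor.map_comp _ _).symm.trans (congrArg H.toFunctor.map ?_)).trans
    (H.toFunctor.map_comp _ _)
  exact (fibreAdj p.proj).counit.naturality m

/-- The comparison `H_∅ (i_R x) ⟶ i_R (H x)`. -/
noncomputable def resKappa (H : FibFunctor p q) (x : p.Total) :
    (resFibre H).obj ((fibreCorefl p.proj).obj x) ⟶
      (fibreCorefl q.proj).obj (H.toFunctor.obj x) :=
  (fibreAdj q.proj).homEquiv _ _ (resCounit H x)

theorem resKappa_naturality (H : FibFunctor p q) {x y : p.Total} (m : x ⟶ y) :
    (resFibre H).map ((fibreCorefl p.proj).map m) ≫ resKappa H y =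
      resKappa H x ≫ (fibreCorefl q.proj).map (H.toFunctor.map m) := by
  rw [resKappa, resKappa, ← Adjunction.homEquiv_naturality_left, resCounit_naturality,
    Adjunction.homEquiv_naturality_right]

/-- `H` preserves the cartesian counit and `i_R` inverts its image; the remaining factor is a unit
of `i ⊣ i_R`, invertible because `i` is fully faithful. -/
instance isIso_resKappa (H : FibFunctor p q) (x : p.Total) : IsIso (resKappa H x) := by
  have h := isIso_fibreCorefl_map q.proj _ _ (isCartesian_resCounit H x)
  rw [resKappa, Adjunction.homEquiv_unit]
  infer_instance

theorem map_resKappa (H : FibFunctor p q) {e : InitialFibre p.proj} {x : p.Total}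
    (k : e ⟶ (fibreCorefl p.proj).obj x) :
    (resFibre H).map k ≫ resKappa H x =
      (fibreAdj q.proj).homEquiv ((resFibre H).obj e) (H.toFunctor.obj x)
        (H.toFunctor.map (((fibreAdj p.proj).homEquiv e x).symm k)) := by
  rw [resKappa, ← Adjunction.homEquiv_naturality_left, map_resCounit]
  rfl

theorem resKappa_id (x : p.Total) : resKappa (FibFunctor.id p) x = 𝟙 _ :=
  homEquiv_counit x

theorem resKappa_comp (H : FibFunctor p q) (K : FibFunctor q r) (x : p.Total) :
    resKappa (H.comp K) x =
      (resFibre K).map (resKappa H x) ≫ resKappa K (H.toFunctor.obj x) := by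
  rw [map_resKappa, resKappa, resKappa, Equiv.symm_apply_apply]
  rfl

/-- The restriction of a vertical transformation to the initial fibres. -/
noncomputable def resTrans {H K : FibFunctor p q} (τ : H ⟶ K) : resFibre H ⟶ resFibre K where
  app e := ⟨τ.nat.app e.1, by
    have h := τ.vertical e.1
    have he : p.proj.obj e.1 = ⊥_ A := e.2
    rw [he] at h
    exact h⟩
  naturality e e' g := Subtype.ext (τ.nat.naturality g.1)

theorem resTrans_kappa {H K : FibFunctor p q} (τ : H ⟶ K) (x : p.Total) :
    resKappa H x ≫ (fibreCorefl q.proj).map (τ.nat.app x) =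
      (resTrans τ).app ((fibreCorefl p.proj).obj x) ≫ resKappa K x := by
  rw [resKappa, resKappa, ← Adjunction.homEquiv_naturality_left,
    ← Adjunction.homEquiv_naturality_right]
  exact congrArg _ (τ.nat.naturality ((fibreAdj p.proj).counit.app x))

variable [IsPruned p.proj] [IsPruned q.proj] [IsPruned r.proj]

/-- The lift whose morphism of parametrized monads is the restriction of `H`. -/
noncomputable def resLift (H : FibFunctor p q) :
    FibredLift p.proj (initialFibreMonad q.proj) where
  G := H.toFunctor ⋙ comparison q.proj
  V := resFibre H
  b x := resBase H x
  b_naturality m := resBase_naturality H m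
  κ x := resKappa H x
  κ_naturality m := resKappa_naturality H m
  isIso_κ x := isIso_resKappa H x

/-- The comparison cell of the restriction of `H`. -/
noncomputable def resDelta (H : FibFunctor p q) (a : A) (e : InitialFibre p.proj) :
    (fibreCorefl q.proj).obj (sumObj q.proj a ((resFibre H).obj e)) ⟶
      (resFibre H).obj ((fibreCorefl p.proj).obj (sumObj p.proj a e)) :=
  (resLift H).delta a e

/-- The morphism `q_L a + i (H_∅ e) ⟶ H (p_L a + i e)`. -/
noncomputable def resSum (H : FibFunctor p q) (a : A) (e : InitialFibre p.proj) :
    sumObj q.proj a ((resFibre H).obj e) ⟶ H.toFunctor.obj (sumObj p.proj a e) :=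
  sumDesc (sumBase p.proj a e ≫ resBase H _)
    (((fibreAdj q.proj).homEquiv _ _).symm
      ((resFibre H).map (sumUnit p.proj a e) ≫ resKappa H _))

/-- The cell becomes `i_R` of a map between objects of `q`, so functoriality of `L` reduces to
comparing the components of `resSum`. -/
theorem resDelta_kappa (H : FibFunctor p q) (a : A) (e : InitialFibre p.proj) :
    resDelta H a e ≫ resKappa H (sumObj p.proj a e) =
      (fibreCorefl q.proj).map (resSum H a e) :=
  ((resLift H).delta_kappa a e).trans (algExtend_sumCounit _ _)

theorem inr_resSum (H : FibFunctor p q) (a : A) (e : InitialFibre p.proj) :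
    coprod.inr ≫ resSum H a e =
      H.toFunctor.map (coprod.inr : (fibreIncl p.proj).obj e ⟶ sumObj p.proj a e) := by
  refine (inr_sumDesc _ _).trans ?_
  rw [map_resKappa]
  refine (Equiv.symm_apply_apply _ _).trans (congrArg _ ?_)
  exact Equiv.symm_apply_apply _ _

theorem sumBase_resSum (H : FibFunctor p q) (a : A) (e : InitialFibre p.proj) :
    sumBase q.proj a _ ≫ q.proj.map (resSum H a e) = sumBase p.proj a e ≫ resBase H _ :=
  sumBase_sumDesc _ _

theorem resSum_id (a : A) (e : InitialFibre p.proj) :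
    resSum (FibFunctor.id p) a e = 𝟙 (sumObj p.proj a e) := by
  refine sum_hom_ext ?_ ((inr_resSum _ _ _).trans (Category.comp_id _).symm)
  refine (sumBase_resSum (FibFunctor.id p) a e).trans ?_
  exact (Category.comp_id _).trans
    ((congrArg (sumBase p.proj a e ≫ ·) (p.proj.map_id _)).trans (Category.comp_id _)).symm

theorem resDelta_id (a : A) (e : InitialFibre p.proj) :
    resDelta (FibFunctor.id p) a e = 𝟙 ((fibreCorefl p.proj).obj (sumObj p.proj a e)) := by
  have h := resDelta_kappa (FibFunctor.id p) a e
  rw [resSum_id, resKappa_id] at h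
  exact (Category.comp_id _).symm.trans (h.trans ((fibreCorefl p.proj).map_id _))

theorem resSum_comp (H : FibFunctor p q) (K : FibFunctor q r) (a : A)
    (e : InitialFibre p.proj) :
    resSum (H.comp K) a e =
      resSum K a ((resFibre H).obj e) ≫ K.toFunctor.map (resSum H a e) := by
  refine sum_hom_ext ((sumBase_resSum (H.comp K) a e).trans ?_)
    ((inr_resSum (H.comp K) a e).trans ?_)
  · have h : sumBase p.proj a e ≫ resBase H _ ≫ resBase K _ =
        sumBase r.proj a _ ≫ r.proj.map (resSum K a ((resFibre H).obj e) ≫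
          K.toFunctor.map (resSum H a e)) := by
      rw [Functor.map_comp, ← Category.assoc (sumBase r.proj a _), sumBase_resSum,
        Category.assoc, ← resBase_naturality, ← Category.assoc (sumBase q.proj a _),
        sumBase_resSum, Category.assoc]
    exact (congrArg (sumBase p.proj a e ≫ ·) (resBase_comp H K _)).trans h
  · refine Eq.trans ?_ (Category.assoc _ _ _)
    refine Eq.trans ?_ (congrArg (· ≫ K.toFunctor.map (resSum H a e)) (inr_resSum K a _)).symm
    exact (congrArg K.toFunctor.map (inr_resSum H a e)).symm.trans (K.toFunctor.map_comp _ _)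

/-- The comparison `resKappa` of the composite functor is cancelled; its factorisation
`resKappa_comp` and naturality then leave `resSum_comp`. -/
theorem resDelta_comp (H : FibFunctor p q) (K : FibFunctor q r) (a : A)
    (e : InitialFibre p.proj) :
    resDelta (H.comp K) a e =
      resDelta K a ((resFibre H).obj e) ≫ (resFibre K).map (resDelta H a e) := by
  refine (cancel_mono (resKappa (H.comp K) (sumObj p.proj a e))).1 ?_
  have h : (fibreCorefl r.proj).map (resSum K a ((resFibre H).obj e) ≫
        K.toFunctor.map (resSum H a e)) =
      (resDelta K a ((resFibre H).obj e) ≫ (resFibre K).map (resDelta H a e)) ≫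
        (resFibre K).map (resKappa H _) ≫ resKappa K _ := by
    rw [Functor.map_comp, ← resDelta_kappa, Category.assoc, ← resKappa_naturality,
      ← resDelta_kappa, Functor.map_comp]
    simp only [Category.assoc]
  refine (resDelta_kappa (H.comp K) a e).trans ?_
  rw [resSum_comp]
  refine h.trans ?_
  rw [resKappa_comp]
  rfl

/-- The morphism of parametrized monads induced by a fibred functor. -/
noncomputable def resHom (H : FibFunctor p q) :
    ParamMonadHom (initialFibreMonad p.proj) (initialFibreMonad q.proj) :=
  (resLift H).toHom

/-- Restriction to the fibres is strictly functorial by definition, so only the cells need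
comparison, here and for composites. This is why `L` is a strict 2-functor. -/
theorem resHom_id : resHom (FibFunctor.id p) = ParamMonadHom.id (initialFibreMonad p.proj) :=
  ParamMonadHom.ext rfl (heq_of_eq (by funext a e; exact resDelta_id a e))

theorem resHom_comp (H : FibFunctor p q) (K : FibFunctor q r) :
    resHom (H.comp K) = (resHom H).comp (resHom K) :=
  ParamMonadHom.ext rfl (heq_of_eq (by funext a e; exact resDelta_comp H K a e))

/-- The 2-cell of parametrized monads induced by a vertical transformation. -/
noncomputable def resHom₂ {H K : FibFunctor p q} (τ : H ⟶ K) : resHom H ⟶ resHom K :=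
  FibredLift.toHom₂ (l := resLift H) (l' := resLift K)
    (Functor.whiskerRight τ.nat (comparison q.proj)) (resTrans τ)
    (resBase_trans τ) (resTrans_kappa τ)

end Restriction

open Bicategory

/-! ### The 2-functor `L`. -/

section LeftAdjoint

variable {A : Type u} [Category.{v} A] [HasInitial A]

/-- In the uses below the two object values agree by definition, so the components of these
`eqToHom`s can be treated as identities. -/
theorem prunedParamMonad_eqToHom_app {T S : PrunedParamMonad.{v, v', u, u'} A} {F G : T ⟶ S}
    (h : F = G) (x : T.mnd.Carrier) :
    (ParamMonadTrans.ν (InducedBicategory.Hom₂.hom (eqToHom h))).app x =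
      eqToHom (congrArg (fun K : T ⟶ S => (ParamMonadHom.V K.hom).obj x) h) := by
  subst h; rfl

variable (A) in
/-- The 2-functor sending a pruned fibration to its parametrized monad. -/
noncomputable def fibTwoFunctor :
    TwoFunctorOn (fibToMonad (A := A) :
      PrunedFib.{v, v', u, u'} A → PrunedParamMonad.{v, v', u, u'} A) where
  map F := InducedBicategory.mkHom (resHom F.hom)
  map₂ α := InducedBicategory.Hom₂.mk (resHom₂ α.hom)
  map₂_id _ := InducedBicategory.hom₂_ext (ParamMonadTrans.hom_ext fun _ => rfl)
  map₂_comp _ _ := InducedBicategory.hom₂_ext (ParamMonadTrans.hom_ext fun _ => rfl)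
  map_id _ := InducedBicategory.hom_ext resHom_id
  map_comp F G := InducedBicategory.hom_ext (resHom_comp F.hom G.hom)
  map₂_whisker_left {p _ r} F _ _ α := InducedBicategory.hom₂_ext
    (ParamMonadTrans.hom_ext fun e =>
      ((congrArg₂ (fun a b => a ≫ (resTrans α.hom).app ((resFibre F.hom).obj e) ≫ b)
        (prunedParamMonad_eqToHom_app (T := fibToMonad p) (S := fibToMonad r) _ e)
        (prunedParamMonad_eqToHom_app (T := fibToMonad p) (S := fibToMonad r) _ e)).trans
        ((Category.id_comp _).trans (Category.comp_id _))).symm)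
  map₂_whisker_right {p _ r _ _} α H := InducedBicategory.hom₂_ext
    (ParamMonadTrans.hom_ext fun e =>
      ((congrArg₂ (fun a b => a ≫ (resFibre H.hom).map ((resTrans α.hom).app e) ≫ b)
        (prunedParamMonad_eqToHom_app (T := fibToMonad p) (S := fibToMonad r) _ e)
        (prunedParamMonad_eqToHom_app (T := fibToMonad p) (S := fibToMonad r) _ e)).trans
        ((Category.id_comp _).trans (Category.comp_id _))).symm)

end LeftAdjoint

/-! ### Isomorphisms of algebras and vertical isomorphisms. -/

section EMIso

variable {A : Type u} [Category.{v} A] {X : Type u'} [Category.{v'} X] {T : A ⥤ Monad X}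

/-- The inverse of a morphism of algebras with invertible components. -/
noncomputable def emInv {P Q : EMObj T} (φ : P ⟶ Q) [IsIso φ.base] [IsIso φ.carrier] : Q ⟶ P where
  base := inv φ.base
  carrier := inv φ.carrier
  comm := by
    have h := algExtend_comp_carrier (inv φ.base) (inv φ.carrier) φ
    rw [IsIso.inv_hom_id, IsIso.inv_hom_id, algExtend_id, ← IsIso.eq_comp_inv] at h
    exact h

/-- A morphism of algebras with invertible components is an isomorphism. -/
noncomputable def emIso {P Q : EMObj T} (φ : P ⟶ Q) [IsIso φ.base] [IsIso φ.carrier] : P ≅ Q where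
  hom := φ
  inv := emInv φ
  hom_inv_id := EMHom.hom_ext (IsIso.hom_inv_id φ.base) (IsIso.hom_inv_id φ.carrier)
  inv_hom_id := EMHom.hom_ext (IsIso.inv_hom_id φ.base) (IsIso.inv_hom_id φ.carrier)

end EMIso

section VerticalIso

variable {A : Type u} [Category.{v} A] {p q : Fib.{v, v', u, u'} A}

/-- A vertical transformation with invertible components is an isomorphism. -/
def fibIso {F G : FibFunctor p q} (α : F ⟶ G) (i : ∀ x, F.toFunctor.obj x ≅ G.toFunctor.obj x)
    (hi : ∀ x, (i x).hom = α.nat.app x) : F ≅ G where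
  hom := α
  inv :=
    { nat :=
        { app := fun x => (i x).inv
          naturality := fun x y m => by
            rw [Iso.comp_inv_eq, Category.assoc, Iso.eq_inv_comp, hi, hi]
            exact (α.nat.naturality m).symm }
      vertical := fun x => by
        have h : q.proj.IsHomLift (𝟙 (p.proj.obj x)) (i x).hom := by
          rw [hi]; exact α.vertical x
        exact IsHomLift.lift_id_inv q.proj (p.proj.obj x) (i x) }
  hom_inv_id := FibTrans.hom_ext fun x =>
    (congrArg (· ≫ (i x).inv) (hi x).symm).trans (i x).hom_inv_id
  inv_hom_id := FibTrans.hom_ext fun x =>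
    (congrArg ((i x).inv ≫ ·) (hi x).symm).trans (i x).inv_hom_id

theorem isHomLift_id_iff {E : Type u'} [Category.{v'} E] (r : E ⥤ A) {a : A} {x y : E}
    (hx : r.obj x = a) (hy : r.obj y = a) (φ : x ⟶ y) :
    r.IsHomLift (𝟙 a) φ ↔ r.map φ = eqToHom (hx.trans hy.symm) := by
  refine ⟨fun h => ?_, fun h => IsHomLift.of_fac' r _ _ hx hy ?_⟩
  · rw [IsHomLift.fac' r (𝟙 a) φ]
    simp
  · rw [h]
    simp

/-- Verticality determines the base components, so the coherence laws of the unit can be checked on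
carriers. The universe levels are ones that `emFib` preserves, so that `p` and `p^S` lie in the same
2-category. -/
theorem emTrans_ext {p : Fib.{v, max v v', u, max u v v' w} A}
    {S : ParamMonad.{v, max v v', u, max u v v' w} A} {F G : FibFunctor p (emFib S)}
    {α β : F ⟶ G}
    (h : ∀ x, EMHom.carrier (α.nat.app x) = EMHom.carrier (β.nat.app x)) : α = β :=
  FibTrans.hom_ext fun x => EMHom.hom_ext
    (((isHomLift_id_iff (emProj S.T) (F.toBasedFunctor.w_obj x) (G.toBasedFunctor.w_obj x) _).1
      (α.vertical x)).trans
    ((isHomLift_id_iff (emProj S.T) (F.toBasedFunctor.w_obj x) (G.toBasedFunctor.w_obj x) _).1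
      (β.vertical x)).symm) (h x)

end VerticalIso

/-! ### The comparison functors as a pseudonatural unit. -/

section Unit

variable {A : Type u} [Category.{v} A] [HasInitial A]

/-- The comparison functor as a fibred functor. -/
noncomputable def comparisonFib (p : Fib.{v, max v v', u, max u v v' w} A) [IsPruned p.proj] :
    FibFunctor p (emFib (initialFibreMonad p.proj)) where
  toFunctor := comparison p.proj
  w := rfl
  preserves_cartesian f _ _ φ h := comparison_isCartesian p.proj f φ h

variable {p : Fib.{v, max v v', u, max u v v' w} A} [IsPruned p.proj]
  {S : ParamMonad.{v, max v v', u, max u v v' w} A}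

/-- The lift given by a fibred functor to an Eilenberg–Moore fibration and a presentation of its
carriers. -/
noncomputable def emLift (G : FibFunctor p (emFib S)) (V : InitialFibre p.proj ⥤ S.Carrier)
    (κ : ∀ x : p.Total, V.obj ((fibreCorefl p.proj).obj x) ⟶ (EMObj.alg (G.toFunctor.obj x) ).A)
    (hκ : ∀ {x y : p.Total} (m : x ⟶ y),
      V.map ((fibreCorefl p.proj).map m) ≫ κ y = κ x ≫ EMHom.carrier (G.toFunctor.map m))
    (hi : ∀ x, IsIso (κ x)) : FibredLift p.proj S where
  G := G.toFunctor
  V := V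
  b x := resBase G x
  b_naturality m := resBase_naturality G m
  κ := κ
  κ_naturality m := hκ m
  isIso_κ := hi

/-- The fibred functor induced by the morphism of a lift is isomorphic to the given one. -/
noncomputable def emLiftIso (G : FibFunctor p (emFib S)) (V : InitialFibre p.proj ⥤ S.Carrier)
    (κ : ∀ x : p.Total, V.obj ((fibreCorefl p.proj).obj x) ⟶ (EMObj.alg (G.toFunctor.obj x) ).A)
    (hκ : ∀ {x y : p.Total} (m : x ⟶ y),
      V.map ((fibreCorefl p.proj).map m) ≫ κ y = κ x ≫ EMHom.carrier (G.toFunctor.map m))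
    (hi : ∀ x, IsIso (κ x)) :
    (comparisonFib p).comp (emMap (emLift G V κ hκ hi).toHom) ≅ G :=
  fibIso
    { nat :=
        { app := fun x => (emLift G V κ hκ hi).counit x
          naturality := fun _ _ m => EMHom.hom_ext (resBase_naturality G m) (hκ m) }
      vertical := fun x =>
        (isHomLift_id_iff (emProj S.T) (a := p.proj.obj x) rfl (G.toBasedFunctor.w_obj x) _).2
          rfl }
    (fun x => @emIso _ _ _ _ _ _ _ ((emLift G V κ hκ hi).counit x)
      (isIso_resBase G x) (hi x))
    (fun _ => rfl)

variable {q r : Fib.{v, max v v', u, max u v v' w} A} [IsPruned q.proj] [IsPruned r.proj]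

/-- The pseudonaturality of the comparison functors. -/
noncomputable def comparisonSquare (H : FibFunctor p q) :
    H.comp (comparisonFib q) ≅ (comparisonFib p).comp (emMap (resHom H)) :=
  (emLiftIso (H.comp (comparisonFib q)) (resFibre H) (resKappa H)
    (resKappa_naturality H) (isIso_resKappa H)).symm

end Unit

section UnitTransformation

variable {A : Type u} [Category.{v} A] [HasInitial A]

theorem monadToFib_eqToHom_carrier {T S : PrunedParamMonad.{v, v', u, u'} A}
    {F G : monadToFib T ⟶ monadToFib S} (h : F = G) (P : EMObj T.mnd.T) :
    EMHom.carrier ((FibTrans.nat (InducedBicategory.Hom₂.hom (eqToHom h))).app P) =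
      eqToHom (congrArg (fun K : monadToFib T ⟶ monadToFib S =>
        (EMObj.alg ((FibFunctor.toBasedFunctor K.hom).toFunctor.obj P)).A) h) := by
  subst h; rfl

variable {p q : Fib.{v, v', u, u'} A}

/-- The naturality cells of the unit run opposite to `emLiftIso`, so their carriers are inverses of
`resKappa`; hence its properties are restated for inverses. -/
theorem inv_resKappa_trans {H K : FibFunctor p q} (τ : H ⟶ K) (x : p.Total) :
    (fibreCorefl q.proj).map (τ.nat.app x) ≫ inv (resKappa K x) =
      inv (resKappa H x) ≫ (resTrans τ).app ((fibreCorefl p.proj).obj x) := by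
  rw [IsIso.comp_inv_eq, Category.assoc, IsIso.eq_inv_comp, resTrans_kappa]

theorem inv_resKappa_id (x : p.Total) : inv (resKappa (FibFunctor.id p) x) = 𝟙 _ := by
  refine (IsIso.inv_eq_of_hom_inv_id ?_)
  rw [resKappa_id]
  exact Category.comp_id _

theorem inv_resKappa_comp {r : Fib.{v, v', u, u'} A} (H : FibFunctor p q) (K : FibFunctor q r)
    (x : p.Total) :
    inv (resKappa (H.comp K) x) =
      inv (resKappa K (H.toFunctor.obj x)) ≫ (resFibre K).map (inv (resKappa H x)) := by
  refine (IsIso.inv_eq_of_hom_inv_id ?_)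
  rw [resKappa_comp]
  have h : ((resFibre K).map (resKappa H x) ≫ resKappa K (H.toFunctor.obj x)) ≫
    inv (resKappa K (H.toFunctor.obj x)) ≫ (resFibre K).map (inv (resKappa H x)) = 𝟙 _ := by
    simp
  exact h

/-- The identity factors here and in `inv_resKappa_padded` come from the unitors, the associators
and the constraints of the identity pseudofunctor when the pseudonaturality axioms are read on
carriers. -/
theorem fibreCorefl_id_padded (x : p.Total) :
    𝟙 _ = (fibreCorefl p.proj).map (𝟙 x) ≫ 𝟙 _ ≫ 𝟙 _ := by
  simp

theorem inv_resKappa_padded {r : Fib.{v, v', u, u'} A} (H : FibFunctor p q)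
    (K : FibFunctor q r) (x : p.Total) :
    inv (resKappa K (H.toFunctor.obj x)) ≫ (resFibre K).map (inv (resKappa H x)) =
      (fibreCorefl r.proj).map (𝟙 (K.toFunctor.obj (H.toFunctor.obj x))) ≫ 𝟙 _ ≫
        inv (resKappa K (H.toFunctor.obj x)) ≫ 𝟙 _ ≫
        (resFibre K).map (inv (resKappa H x)) ≫ 𝟙 _ := by
  simp

variable (A) in
/-- The unit of the 2-dimensional adjunction, given by the comparison functors. -/
noncomputable def comparisonUnit :
    Pseudofunctor.StrongTrans (Pseudofunctor.id (PrunedFib.{v, max v v', u, max u v v' w} A))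
      ((fibTwoFunctor A).toStrict.toPseudofunctor.comp
        (emPrunedTwoFunctor.{v, max v v', u, max u v v' w} A).toPseudofunctor) where
  app p := InducedBicategory.mkHom (comparisonFib p.fib)
  naturality f := InducedBicategory.isoMk (comparisonSquare f.hom)
  naturality_naturality η := InducedBicategory.hom₂_ext
    (emTrans_ext fun x => inv_resKappa_trans η.hom x)
  naturality_id p := InducedBicategory.hom₂_ext (emTrans_ext fun x => by
    -- The identity constraint of `RL` is `R` applied to that of `L`, followed by that of `R`; `h₁`
    -- and `h₂` treat the two factors.
    have h₁ := prunedParamMonad_eqToHom_app (T := fibToMonad p) (S := fibToMonad p)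
      ((fibTwoFunctor A).map_id p) ((fibreCorefl p.fib.proj).obj x)
    have h₂ := monadToFib_eqToHom_carrier
      ((emPrunedTwoFunctor A).map_id (fibToMonad p)) ((comparison p.fib.proj).obj x)
    refine (congrArg₂ (fun a b => a ≫ b) (inv_resKappa_id x)
      (congrArg₂ (fun a b => a ≫ b) h₁ h₂)).trans ?_
    exact (Category.id_comp _).trans ((Category.id_comp _).trans (fibreCorefl_id_padded x)))
  naturality_comp {p q r} f g := InducedBicategory.hom₂_ext (emTrans_ext fun x => by
    have h₁ := prunedParamMonad_eqToHom_app (T := fibToMonad p) (S := fibToMonad r)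
      ((fibTwoFunctor A).map_comp f g) ((fibreCorefl p.fib.proj).obj x)
    have h₂ := monadToFib_eqToHom_carrier
      ((emPrunedTwoFunctor A).map_comp ((fibTwoFunctor A).map f) ((fibTwoFunctor A).map g))
      ((comparison p.fib.proj).obj x)
    refine (congrArg₂ (fun a b => a ≫ b) (inv_resKappa_comp f.hom g.hom x)
      (congrArg₂ (fun a b => a ≫ b) h₁ h₂)).trans ?_
    refine (congrArg _ (Category.id_comp _)).trans ((Category.comp_id _).trans ?_)
    exact inv_resKappa_padded f.hom g.hom x)

end UnitTransformation

/-! ### Transposition along the unit. -/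

section Transpose

/-- This merges the two naturality conditions on the cells of `K`: its underlying functor preserves
extensions up to these cells. -/
theorem ParamMonadHom.algExtend_map {A : Type u} [Category.{v} A]
    {T S : ParamMonad.{v, v', u, u'} A} (K : ParamMonadHom T S) {a b : A} {x y : T.Carrier}
    (f : a ⟶ b) (k : x ⟶ y) (ξ : (T.T.obj b).obj y ⟶ y) :
    algExtend S.T f (K.V.map k) (K.δ b y ≫ K.V.map ξ) =
      K.δ a x ≫ K.V.map (algExtend T.T f k ξ) := by
  have h₁ := K.naturality_carrier b k
  have h₂ := K.naturality_param f x
  dsimp only [algExtend]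
  rw [reassoc_of% h₁, reassoc_of% h₂, K.V.map_comp, K.V.map_comp]

variable {A : Type u} [Category.{v} A] [HasInitial A] {E : Type u'} [Category.{v'} E]
  {p : E ⥤ A} [p.IsFibered]

theorem algExtend_sumBase_sumUnit [IsPruned p] (a : A) (e : InitialFibre p) :
    algExtend (fibParamMonad p) (sumBase p a e) (sumUnit p a e)
      ((fibreCorefl p).map (sumCounit p (sumObj p a e))) = 𝟙 _ := by
  rw [algExtend_sumCounit, sumUnit, Equiv.symm_apply_apply]
  refine (congrArg (fibreCorefl p).map (sum_hom_ext (n := 𝟙 _) ?_ ?_)).trans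
    ((fibreCorefl p).map_id _)
  · rw [sumBase_sumDesc, p.map_id, Category.comp_id]
  · rw [inr_sumDesc, Category.comp_id]

/-- The canonical lift whose morphism of parametrized monads is `K`. -/
noncomputable def homLift [IsPruned p] {S : ParamMonad.{v, v', u, u'} A}
    (K : ParamMonadHom (initialFibreMonad p) S) : FibredLift p S where
  G := comparison p ⋙ emMapFunctor K
  V := K.V
  b x := 𝟙 (p.obj x)
  b_naturality m := (Category.comp_id (p.map m)).trans (Category.id_comp (p.map m)).symm
  κ x := 𝟙 (K.V.obj ((fibreCorefl p).obj x))
  κ_naturality m := (Category.comp_id (K.V.map ((fibreCorefl p).map m))).trans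
    (Category.id_comp (K.V.map ((fibreCorefl p).map m))).symm
  isIso_κ x := inferInstanceAs (IsIso (𝟙 (K.V.obj ((fibreCorefl p).obj x))))

/-- By `algExtend_map`, the cell of the lift is that of `K` followed by the image of the extension
of the canonical data on `p_L a + i e`, which is an identity. -/
theorem homLift_delta [IsPruned p] {S : ParamMonad.{v, v', u, u'} A}
    (K : ParamMonadHom (initialFibreMonad p) S) (a : A) (e : InitialFibre p) :
    (homLift K).delta a e = K.δ a e := by
  have h := (homLift K).delta_kappa a e
  have h₁ : algExtend S.T (sumBase p a e ≫ 𝟙 _) (K.V.map (sumUnit p a e) ≫ 𝟙 _)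
      (K.δ (p.obj (sumObj p a e)) ((fibreCorefl p).obj (sumObj p a e)) ≫
        K.V.map ((fibreCorefl p).map (sumCounit p (sumObj p a e)))) = K.δ a e := by
    rw [Category.comp_id, Category.comp_id]
    refine (K.algExtend_map _ _ _).trans ?_
    refine (congrArg (fun t => K.δ a e ≫ K.V.map t) (algExtend_sumBase_sumUnit a e)).trans ?_
    exact (congrArg (K.δ a e ≫ ·) (K.V.map_id _)).trans (Category.comp_id _)
  exact (Category.comp_id _).symm.trans (h.trans h₁)

/-- The unit of `i ⊣ i_R` is invertible, so each `e` is isomorphic to `i_R (i e)`. -/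
theorem natTrans_ext_fibreCorefl {C : Type u₁} [Category.{v₁} C] {V W : InitialFibre p ⥤ C}
    {ν ν' : V ⟶ W}
    (h : ∀ x : E, ν.app ((fibreCorefl p).obj x) = ν'.app ((fibreCorefl p).obj x)) : ν = ν' := by
  ext e
  rw [← cancel_mono (W.map ((fibreAdj p).unit.app e)), ← ν.naturality, ← ν'.naturality]
  exact congrArg _ (h _)

/-- The transformation on the initial fibre determined by its values on the image of `i_R`. -/
noncomputable def natTransOfCorefl {C : Type u₁} [Category.{v₁} C] {V W : InitialFibre p ⥤ C}
    (t : fibreCorefl p ⋙ V ⟶ fibreCorefl p ⋙ W) : V ⟶ W :=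
  Functor.whiskerRight (fibreAdj p).unit V ≫ Functor.whiskerLeft (fibreIncl p) t ≫
    Functor.whiskerRight (inv (fibreAdj p).unit) W

/-- At `i_R x` the inverse of the unit is `i_R` of the counit, by a triangle identity; naturality of
`t` at the counit then cancels it against the unit. -/
theorem natTransOfCorefl_app {C : Type u₁} [Category.{v₁} C] {V W : InitialFibre p ⥤ C}
    (t : fibreCorefl p ⋙ V ⟶ fibreCorefl p ⋙ W) (x : E) :
    (natTransOfCorefl t).app ((fibreCorefl p).obj x) = t.app x := by
  have h₁ := (fibreAdj p).right_triangle_components x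
  have h₂ : (inv (fibreAdj p).unit).app ((fibreCorefl p).obj x) =
      (fibreCorefl p).map ((fibreAdj p).counit.app x) := by
    rw [NatIso.isIso_inv_app]
    exact IsIso.inv_eq_of_hom_inv_id h₁
  have h₃ : V.map ((fibreCorefl p).map ((fibreAdj p).counit.app x)) ≫ t.app x =
      t.app _ ≫ W.map ((fibreCorefl p).map ((fibreAdj p).counit.app x)) :=
    t.naturality ((fibreAdj p).counit.app x)
  have h₄ : (natTransOfCorefl t).app ((fibreCorefl p).obj x) =
      V.map ((fibreAdj p).unit.app ((fibreCorefl p).obj x)) ≫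
      t.app ((fibreIncl p).obj ((fibreCorefl p).obj x)) ≫
      W.map ((inv (fibreAdj p).unit).app ((fibreCorefl p).obj x)) := rfl
  rw [h₄, h₂]
  refine (congrArg (V.map ((fibreAdj p).unit.app ((fibreCorefl p).obj x)) ≫ ·) h₃.symm).trans ?_
  rw [← Category.assoc, ← V.map_comp]
  refine (congrArg (fun s => V.map s ≫ t.app x) h₁).trans ?_
  rw [V.map_id]
  exact Category.id_comp _

end Transpose

section TransposeEquivalence

variable {A : Type u} [Category.{v} A] [HasInitial A]
  {p : Fib.{v, max v v', u, max u v v' w} A}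
  {S : ParamMonad.{v, max v v', u, max u v v' w} A}

/-- The functor on the initial fibre given by the carriers of a fibred functor. -/
noncomputable def carrierFunctor (G : FibFunctor p (emFib S)) :
    InitialFibre p.proj ⥤ S.Carrier :=
  fibreIncl p.proj ⋙ G.toFunctor ⋙ emCarrier S.T

/-- The presentation of the carriers of a fibred functor. -/
noncomputable def carrierKappa (G : FibFunctor p (emFib S)) (x : p.Total) :
    (carrierFunctor G).obj ((fibreCorefl p.proj).obj x) ⟶ (EMObj.alg (G.toFunctor.obj x)).A :=
  EMHom.carrier (G.toFunctor.map ((fibreAdj p.proj).counit.app x))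

theorem carrierKappa_naturality (G : FibFunctor p (emFib S)) {x y : p.Total} (m : x ⟶ y) :
    (carrierFunctor G).map ((fibreCorefl p.proj).map m) ≫ carrierKappa G y =
      carrierKappa G x ≫ EMHom.carrier (G.toFunctor.map m) := by
  have h := congrArg (fun t => (emCarrier S.T).map (G.toFunctor.map t))
    ((fibreAdj p.proj).counit.naturality m)
  refine Eq.trans ?_ (h.trans ?_)
  · exact (((emCarrier S.T).map_comp _ _).symm.trans
      (congrArg (emCarrier S.T).map (G.toFunctor.map_comp _ _).symm))
  · exact (congrArg (emCarrier S.T).map (G.toFunctor.map_comp _ _)).trans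
      ((emCarrier S.T).map_comp _ _)

/-- `G` preserves the cartesian counit, and cartesian morphisms between algebras have invertible
carriers. -/
theorem isIso_carrierKappa (G : FibFunctor p (emFib S)) (x : p.Total) :
    IsIso (carrierKappa G x) :=
  emProj_isIso_carrier _ _ (G.preserves_cartesian _ _ (isCartesian_fibreAdj_counit p.proj x))

variable [IsPruned p.proj]

/-- A fibred functor to an Eilenberg–Moore fibration as a lift. -/
noncomputable def carrierLift (G : FibFunctor p (emFib S)) : FibredLift p.proj S :=
  emLift G (carrierFunctor G) (carrierKappa G) (carrierKappa_naturality G) (isIso_carrierKappa G)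

/-- Every fibred functor to an Eilenberg–Moore fibration factors through the comparison functor. -/
noncomputable def carrierLiftIso (G : FibFunctor p (emFib S)) :
    (comparisonFib p).comp (emMap (carrierLift G).toHom) ≅ G :=
  emLiftIso G (carrierFunctor G) (carrierKappa G) (carrierKappa_naturality G)
    (isIso_carrierKappa G)

/-- This gives fullness of transposition. The carriers of `τ` are given on objects `i_R x` and
spread to the whole fibre by `natTransOfCorefl`; `delta_comm` for the canonical lifts then yields
the 2-cell law. -/
theorem exists_hom₂_of_fibTrans {K K' : ParamMonadHom (initialFibreMonad p.proj) S}
    (τ : (comparisonFib p).comp (emMap K) ⟶ (comparisonFib p).comp (emMap K')) :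
    ∃ α : K ⟶ K', ∀ x : p.Total,
      α.ν.app ((fibreCorefl p.proj).obj x) = EMHom.carrier (τ.nat.app x) := by
  let σ : (homLift K).G ⟶ (homLift K').G := τ.nat
  let t : fibreCorefl p.proj ⋙ K.V ⟶ fibreCorefl p.proj ⋙ K'.V :=
    { app := fun x => (σ.app x).carrier
      naturality := fun _ _ m => congrArg EMHom.carrier (σ.naturality m) }
  have hb (x : p.Total) : (𝟙 (p.proj.obj x)) ≫ (σ.app x).base = 𝟙 (p.proj.obj x) :=
    (Category.id_comp _).trans
      ((isHomLift_id_iff (emProj S.T) (a := p.proj.obj x) rfl rfl (σ.app x)).1 (τ.vertical x))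
  have hκ (x : p.Total) : 𝟙 (K.V.obj ((fibreCorefl p.proj).obj x)) ≫ (σ.app x).carrier =
      (natTransOfCorefl t).app ((fibreCorefl p.proj).obj x) ≫ 𝟙 _ :=
    (Category.id_comp _).trans
      ((natTransOfCorefl_app t x).symm.trans (Category.comp_id _).symm)
  have hc := FibredLift.delta_comm (l := homLift K) (l' := homLift K') σ
    (natTransOfCorefl t) hb hκ
  refine ⟨⟨natTransOfCorefl t, fun a e => ?_⟩, fun x => natTransOfCorefl_app t x⟩
  have h := hc a e
  rw [homLift_delta, homLift_delta] at h
  exact h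

/-- Transposition along the comparison functor is an equivalence. -/
theorem transpose_isEquivalence (p : PrunedFib.{v, max v v', u, max u v v' w} A)
    (S : PrunedParamMonad.{v, max v v', u, max u v v' w} A) :
    (transposeFunctor (emPrunedTwoFunctor.{v, max v v', u, max u v v' w} A).toPseudofunctor
      ((comparisonUnit A).app p) S).IsEquivalence where
  faithful := ⟨fun {K K'} α β h => InducedBicategory.hom₂_ext (ParamMonadTrans.ext
    (natTrans_ext_fibreCorefl (p := p.fib.proj) fun x =>
      congrArg (fun t => EMHom.carrier ((FibTrans.nat (InducedBicategory.Hom₂.hom t)).app x)) h))⟩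
  full := ⟨fun {K K'} τ => by
    obtain ⟨α, hα⟩ := exists_hom₂_of_fibTrans (p := p.fib) (S := S.mnd) τ.hom
    exact ⟨InducedBicategory.Hom₂.mk α, InducedBicategory.hom₂_ext (emTrans_ext hα)⟩⟩
  essSurj := ⟨fun G => ⟨InducedBicategory.mkHom (carrierLift (p := p.fib) (S := S.mnd) G.hom).toHom,
    ⟨InducedBicategory.isoMk (carrierLiftIso (p := p.fib) (S := S.mnd) G.hom)⟩⟩⟩

variable (A) in
/-- The 2-dimensional adjunction between pruned fibrations and pruned parametrized monads. -/
noncomputable def fibMonadBiadjunction :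
    Biadjunction
      (fibTwoFunctor.{v, max v v', u, max u v v' w} A).toStrict.toPseudofunctor
      (emPrunedTwoFunctor.{v, max v v', u, max u v v' w} A).toPseudofunctor where
  unit := comparisonUnit A
  isEquivalence p S := transpose_isEquivalence p S

end TransposeEquivalence

/-! ### Fibred equivalences. -/

section QuasiInverse

variable {A : Type u} [Category.{v} A] {p q : Fib.{v, v', u, u'} A}

/-- Every object is vertically isomorphic to a value of a fibred equivalence. -/
theorem exists_vertical_iso (F : FibFunctor p q) [F.toFunctor.EssSurj] (y : q.Total) :
    ∃ (x : p.Total) (i : F.toFunctor.obj x ≅ y), p.proj.obj x = q.proj.obj y ∧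
      q.proj.IsHomLift (𝟙 (q.proj.obj y)) i.hom := by
  let z := F.toFunctor.objPreimage y
  let j : F.toFunctor.obj z ≅ y := F.toFunctor.objObjPreimageIso y
  have hz : q.proj.obj (F.toFunctor.obj z) = p.proj.obj z := F.toBasedFunctor.w_obj z
  -- The preimage `z` has a base only isomorphic to that of `y`. A cartesian lift of this
  -- isomorphism is invertible and moves `z` strictly over the base of `y`.
  let f : q.proj.obj y ⟶ p.proj.obj z := q.proj.map j.inv ≫ eqToHom hz
  obtain ⟨x, φ, hφ⟩ := Functor.IsPreFibered.exists_isCartesian' (p := p.proj) f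
  have hs : p.proj.IsStronglyCartesian f φ := inferInstance
  have hi : IsIso φ := Functor.IsStronglyCartesian.isIso_of_base_isIso p.proj f φ
  have hl : q.proj.IsHomLift f (F.toFunctor.map φ) :=
    (F.preserves_cartesian f φ hφ).toIsHomLift
  have hj : q.proj.IsHomLift (eqToHom hz.symm ≫ q.proj.map j.hom) j.hom := inferInstance
  refine ⟨x, F.toFunctor.mapIso (asIso φ) ≪≫ j, IsHomLift.domain_eq p.proj f φ, ?_⟩
  have hc : q.proj.IsHomLift (f ≫ eqToHom hz.symm ≫ q.proj.map j.hom)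
      (F.toFunctor.map φ ≫ j.hom) := inferInstance
  have hf : f ≫ eqToHom hz.symm ≫ q.proj.map j.hom = 𝟙 _ := by
    simp [f, ← Functor.map_comp]
  rw [hf] at hc
  exact hc

/-- A fully faithful fibred functor reflects cartesian morphisms. -/
theorem isCartesian_of_map (F : FibFunctor p q) [F.toFunctor.Full] [F.toFunctor.Faithful]
    {a b : A} (f : a ⟶ b) {x y : p.Total} (φ : x ⟶ y)
    (h : q.proj.IsCartesian f (F.toFunctor.map φ)) : p.proj.IsCartesian f φ := by
  have hl : p.proj.IsHomLift f φ := F.toBasedFunctor.isHomLift_map f φ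
  refine { toIsHomLift := hl, universal_property := fun {z} ψ hψ => ?_ }
  have hψ' : q.proj.IsHomLift f (F.toFunctor.map ψ) :=
    F.toBasedFunctor.preserves_isHomLift f ψ
  obtain ⟨χ, ⟨hχ, hc⟩, hu⟩ := h.universal_property (F.toFunctor.map ψ)
  obtain ⟨θ, rfl⟩ := F.toFunctor.map_surjective χ
  refine ⟨θ, ⟨F.toBasedFunctor.isHomLift_map _ θ, F.toFunctor.map_injective ?_⟩, ?_⟩
  · rw [Functor.map_comp, hc]
  · rintro θ' ⟨hθ', hcomp⟩
    refine F.toFunctor.map_injective (hu _ ⟨F.toBasedFunctor.preserves_isHomLift _ θ', ?_⟩)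
    rw [← Functor.map_comp, hcomp]

/-- A fibred functor which is an equivalence of categories is an equivalence in the 2-category
of fibrations. -/
theorem nonempty_equivalence_of_isEquivalence (F : FibFunctor p q)
    [F.toFunctor.IsEquivalence] : Nonempty (Bicategory.Equivalence p q) := by
  -- Since `o y` lies exactly over the base of `y` and `i y` is vertical, the quasi-inverse commutes
  -- strictly with the projections.
  choose o i ho hi using exists_vertical_iso F
  have hmap {y y' : q.Total} (g : y ⟶ y') :
      ∃ k : o y ⟶ o y', F.toFunctor.map k = (i y).hom ≫ g ≫ (i y').inv :=
    F.toFunctor.map_surjective _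
  choose m hm using @hmap
  let W : q.Total ⥤ p.Total :=
    { obj := o
      map := m
      map_id := fun y => F.toFunctor.map_injective (by rw [hm]; simp)
      map_comp := fun g h => F.toFunctor.map_injective (by
        rw [hm, Functor.map_comp, hm, hm]; simp) }
  have hlift {a b : A} (f : a ⟶ b) {y y' : q.Total} (g : y ⟶ y') (hg : q.proj.IsHomLift f g) :
      q.proj.IsHomLift f (F.toFunctor.map (m g)) := by
    obtain rfl := IsHomLift.domain_eq q.proj f g
    obtain rfl := IsHomLift.codomain_eq q.proj f g
    have h₁ := hi y
    have h₂ := hi y'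
    rw [hm]
    have h₃ : q.proj.IsHomLift (𝟙 (q.proj.obj y) ≫ f ≫ 𝟙 (q.proj.obj y'))
      ((i y).hom ≫ g ≫ (i y').inv) := inferInstance
    simpa using h₃
  have hlift' {y y' : q.Total} (g : y ⟶ y') : p.proj.IsHomLift (q.proj.map g) (m g) := by
    have h := hlift (q.proj.map g) g inferInstance
    exact F.toBasedFunctor.isHomLift_map _ _
  let W' : FibFunctor q p :=
    { toFunctor := W
      w := CategoryTheory.Functor.ext ho (fun y y' g => by
        have h := hlift' g
        have h' := IsHomLift.fac' p.proj (q.proj.map g) (m g)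
        exact h')
      preserves_cartesian := fun {a b} f {y y'} g hg => by
        refine isCartesian_of_map F f (m g) ?_
        obtain rfl := IsHomLift.domain_eq q.proj f g
        obtain rfl := IsHomLift.codomain_eq q.proj f g
        have h₁ := hi y
        have h₂ := hi y'
        have h₃ : q.proj.IsHomLift (𝟙 (q.proj.obj y')) (i y').symm.hom :=
          IsHomLift.lift_id_inv q.proj _ (i y')
        rw [hm]
        have h₄ : q.proj.IsCartesian f (g ≫ (i y').symm.hom) := inferInstance
        exact Functor.IsCartesian.of_iso_comp q.proj f (g ≫ (i y').symm.hom) (i y) }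
  let c₀ : FibFunctor.comp W' F ≅ FibFunctor.id q :=
    fibIso (F := W'.comp F) (G := FibFunctor.id q)
      { nat :=
          { app := fun y => (i y).hom
            naturality := fun y y' g => by
              change F.toFunctor.map (m g) ≫ (i y').hom = (i y).hom ≫ g
              rw [hm]; simp }
        vertical := hi } i (fun _ => rfl)
  have hk (x : p.Total) : ∃ k : x ≅ o (F.toFunctor.obj x),
      F.toFunctor.map k.hom = (i (F.toFunctor.obj x)).inv :=
    ⟨F.toFunctor.preimageIso (i _).symm, by simp⟩
  choose k hk using hk
  let u₀ : FibFunctor.id p ≅ F.comp W' :=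
    fibIso (F := FibFunctor.id p) (G := F.comp W')
      { nat :=
          { app := fun x => (k x).hom
            naturality := fun x x' g => by
              refine F.toFunctor.map_injective ?_
              change F.toFunctor.map (g ≫ (k x').hom) =
                F.toFunctor.map ((k x).hom ≫ m (F.toFunctor.map g))
              rw [Functor.map_comp, Functor.map_comp, hk, hk, hm]
              simp }
        vertical := fun x => by
          have h₁ := hi (F.toFunctor.obj x)
          have hx : q.proj.obj (F.toFunctor.obj x) = p.proj.obj x := F.toBasedFunctor.w_obj x
          rw [hx] at h₁
          have h₂ : q.proj.IsHomLift (𝟙 (p.proj.obj x)) (F.toFunctor.map (k x).hom) := by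
            rw [hk]
            exact IsHomLift.lift_id_inv q.proj _ _
          exact F.toBasedFunctor.isHomLift_map _ (k x).hom } k (fun _ => rfl)
  -- An equivalence in a bicategory includes a triangle identity; it is secured by replacing the
  -- counit `c₀`.
  exact ⟨Bicategory.Equivalence.mkOfAdjointifyCounit (a := p) (b := q) (f := F) (g := W') u₀ c₀⟩

theorem isEquivalence_of_equivalence (e : Bicategory.Equivalence p q) :
    (FibFunctor.toBasedFunctor e.hom).toFunctor.IsEquivalence := by
  let iso {r s : Fib.{v, v', u, u'} A} {F G : FibFunctor r s} (i : F ≅ G) :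
      F.toFunctor ≅ G.toFunctor :=
    { hom := i.hom.nat
      inv := i.inv.nat
      hom_inv_id := congrArg FibTrans.nat i.hom_inv_id
      inv_hom_id := congrArg FibTrans.nat i.inv_hom_id }
  exact (CategoryTheory.Equivalence.mk (FibFunctor.toBasedFunctor e.hom).toFunctor
    (FibFunctor.toBasedFunctor e.inv).toFunctor (iso e.unit) (iso e.counit)).isEquivalence_functor

end QuasiInverse

/-! ### Recognition of Eilenberg–Moore fibrations. -/

section InitialAlgebras

variable {A : Type u} [Category.{v} A] [HasInitial A] {X : Type u₁} [Category.{v₁} X]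
  {T : A ⥤ Monad X}

theorem isIso_unit_of_base_eq (i : T.obj (⊥_ A) ≅ Monad.id X) {b : A} (hb : b = ⊥_ A) (x : X) :
    IsIso ((T.obj b).η.app x) := by
  subst hb
  exact isIso_unit_of_iso_id i x

/-- Every morphism of carriers out of an algebra over `∅` is a morphism of algebras. -/
noncomputable def emHomOfInitial (i : T.obj (⊥_ A) ≅ Monad.id X) {P Q : EMObj T}
    (hP : P.base = ⊥_ A) (k : P.alg.A ⟶ Q.alg.A) : P ⟶ Q where
  base := eqToHom hP ≫ initial.to Q.base
  carrier := k
  comm := by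
    have hη := isIso_unit_of_base_eq i hP P.alg.A
    -- Over `∅` the unit is invertible, so the law may be tested after it, where the unit laws make
    -- both sides equal to `k`.
    rw [← cancel_epi ((T.obj P.base).η.app P.alg.A), P.alg.unit_assoc]
    exact unit_algExtend (eqToHom hP ≫ initial.to Q.base) k

theorem emHom_ext_of_initial {P Q : EMObj T} (hP : P.base = ⊥_ A) {φ ψ : P ⟶ Q}
    (h : φ.carrier = ψ.carrier) : φ = ψ :=
  EMHom.hom_ext (base_hom_ext hP _ _) h

variable {E : Type u'} [Category.{v'} E] {p : E ⥤ A} [IsPruned p]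

/-- An equivalence to an Eilenberg–Moore fibration sends `p_L a + i e` to a free algebra. -/
theorem isIso_freeEMDesc_inr (i : T.obj (⊥_ A) ≅ Monad.id X) (G : E ⥤ EMObj T) [G.IsEquivalence]
    (b : ∀ x : E, p.obj x ⟶ (G.obj x).base) (hi : ∀ x, IsIso (b x))
    (hb : ∀ {x y : E} (m : x ⟶ y), p.map m ≫ b y = b x ≫ (G.map m).base)
    (a : A) (e : InitialFibre p) (he : (G.obj ((fibreIncl p).obj e)).base = ⊥_ A) :
    IsIso (freeEMDesc (P := G.obj (sumObj p a e)) (sumBase p a e ≫ b _)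
      (G.map (coprod.inr : (fibreIncl p).obj e ⟶ sumObj p a e)).carrier) := by
  let F := freeEM T a (G.obj ((fibreIncl p).obj e)).alg.A
  let D : F ⟶ G.obj (sumObj p a e) := freeEMDesc (P := G.obj (sumObj p a e))
    (sumBase p a e ≫ b _) (G.map (coprod.inr : (fibreIncl p).obj e ⟶ sumObj p a e)).carrier
  -- The monad unit, as a morphism from an algebra over `∅`, plays the role of the second
  -- coprojection into the free algebra.
  let j : G.obj ((fibreIncl p).obj e) ⟶ F := emHomOfInitial i he ((T.obj a).η.app _)
  have hjD : j ≫ D = G.map coprod.inr := emHom_ext_of_initial he (freeEMDesc_unit _ _)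
  let Z := G.objPreimage F
  let z : G.obj Z ≅ F := G.objObjPreimageIso F
  have hz : (z.inv).base ≫ (z.hom).base = 𝟙 a := congrArg EMHom.base z.inv_hom_id
  let f : a ⟶ (G.obj Z).base := (z.inv).base
  -- The inverse of `D` is built in `E` from the coproduct property: `Z` stands for the free
  -- algebra, and the components of `m` are its base map and `j`.
  let m : sumObj p a e ⟶ Z := sumDesc (f ≫ inv (b Z)) (G.preimage (j ≫ z.inv))
  have hm : G.map coprod.inr ≫ G.map m ≫ z.hom = j := by
    rw [← Category.assoc, ← G.map_comp, inr_sumDesc, G.map_preimage, Category.assoc,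
      z.inv_hom_id, Category.comp_id]
  have hmb : (sumBase p a e ≫ b _) ≫ (G.map m).base = f := by
    rw [Category.assoc, ← hb, ← Category.assoc, sumBase_sumDesc, Category.assoc,
      IsIso.inv_hom_id, Category.comp_id]
  have h₁ : D ≫ G.map m ≫ z.hom = 𝟙 F := by
    refine freeEM_hom_ext ?_ ?_
    · have : ((sumBase p a e ≫ b _) ≫ (G.map m).base) ≫ (z.hom).base = 𝟙 a := by
        rw [hmb]; exact hz
      exact (Category.assoc _ _ _).symm.trans this
    · have h₃ : j.carrier ≫ D.carrier = (G.map coprod.inr).carrier := congrArg EMHom.carrier hjD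
      refine (Category.assoc _ _ _).symm.trans ?_
      refine (congrArg (· ≫ (G.map m ≫ z.hom).carrier) h₃).trans ?_
      exact (congrArg EMHom.carrier hm).trans (Category.comp_id _).symm
  have h₂ : G.map m ≫ z.hom ≫ D = 𝟙 _ := by
    obtain ⟨n, hn⟩ := G.map_surjective (z.hom ≫ D)
    -- Fullness brings the other composite back to `E`, where it is an endomorphism of the coproduct
    -- and is tested on its two components.
    have hmn : m ≫ n = 𝟙 _ := by
      refine sum_hom_ext ?_ (G.map_injective ?_)
      · rw [← cancel_mono (b _), p.map_id, Category.comp_id, Category.assoc, hb,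
          ← Category.assoc, G.map_comp, hn]
        refine (Category.assoc _ _ _).symm.trans ?_
        rw [hmb]
        exact (Category.assoc _ _ _).symm.trans
          ((congrArg (· ≫ D.base) hz).trans (Category.id_comp _))
      · rw [G.map_comp, G.map_comp, hn, ← Category.assoc, ← Category.assoc, Category.assoc _ _ z.hom,
          hm, hjD, Category.comp_id]
    rw [← hn, ← G.map_comp, hmn, G.map_id]
  exact ⟨G.map m ≫ z.hom, h₁, (Category.assoc _ _ _).trans h₂⟩

end InitialAlgebras

section FullyFaithful

variable {A : Type u} [Category.{v} A] {T S : ParamMonad.{v, v', u, u'} A}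
  (K : ParamMonadHom T S)

theorem emMapFunctor_faithful [K.V.Faithful] : (emMapFunctor K).Faithful :=
  ⟨fun {_ _} _ _ h => EMHom.hom_ext (congrArg (emProj S.T).map h)
    (K.V.map_injective (congrArg (emCarrier S.T).map h))⟩

/-- A preimage of the carrier is an algebra morphism: its law holds after applying the faithful
`K.V` and precomposing with the invertible cell. -/
theorem emMapFunctor_full [K.V.Faithful] [K.V.Full] (h : ∀ a x, IsIso (K.δ a x)) :
    (emMapFunctor K).Full := by
  refine ⟨fun {P Q} φ => ?_⟩
  obtain ⟨k, hk⟩ : ∃ k, K.V.map k = φ.carrier := K.V.map_surjective _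
  let f : P.base ⟶ Q.base := φ.base
  have hc : algExtend T.T f k Q.alg.a = P.alg.a ≫ k := by
    refine K.V.map_injective ?_
    have := h P.base P.alg.A
    rw [← cancel_epi (K.δ P.base P.alg.A), ← K.algExtend_map, K.V.map_comp, ← Category.assoc, hk]
    exact φ.comm
  exact ⟨⟨f, k, hc⟩, EMHom.hom_ext rfl hk⟩

end FullyFaithful

section Recognition

variable {A : Type u} [Category.{v} A] [HasInitial A]
  {p : Fib.{v, max v v', u, max u v v' w} A}
  {S : ParamMonad.{v, max v v', u, max u v v' w} A} (G : FibFunctor p (emFib S))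

theorem base_fibreIncl (e : InitialFibre p.proj) :
    EMObj.base (G.toFunctor.obj ((fibreIncl p.proj).obj e)) = ⊥_ A :=
  (G.toBasedFunctor.w_obj _).trans e.2

theorem carrierFunctor_map_kappa {e : InitialFibre p.proj} {x : p.Total}
    (k : e ⟶ (fibreCorefl p.proj).obj x) :
    (carrierFunctor G).map k ≫ carrierKappa G x =
      EMHom.carrier (G.toFunctor.map (((fibreAdj p.proj).homEquiv e x).symm k)) := by
  rw [Adjunction.homEquiv_counit, Functor.map_comp]
  rfl

variable [G.toFunctor.IsEquivalence]

theorem carrierFunctor_faithful : (carrierFunctor G).Faithful :=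
  ⟨fun {e _} _ _ h => (fibreIncl p.proj).map_injective (G.toFunctor.map_injective
    (emHom_ext_of_initial (base_fibreIncl G e) h))⟩

/-- Triviality of `S_∅` enters here: every map of carriers out of an algebra over `∅` underlies an
algebra morphism. Faithfulness above uses only that base maps out of `∅` are unique. -/
theorem carrierFunctor_full (i : S.T.obj (⊥_ A) ≅ Monad.id S.Carrier) :
    (carrierFunctor G).Full := by
  refine ⟨fun {e e'} k => ?_⟩
  let φ : G.toFunctor.obj ((fibreIncl p.proj).obj e) ⟶
      G.toFunctor.obj ((fibreIncl p.proj).obj e') := emHomOfInitial i (base_fibreIncl G e) k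
  refine ⟨(fibreIncl p.proj).preimage (G.toFunctor.preimage φ), ?_⟩
  change (emCarrier S.T).map (G.toFunctor.map ((fibreIncl p.proj).map _)) = k
  rw [Functor.map_preimage, Functor.map_preimage]
  rfl

variable [IsPruned p.proj]

/-- Followed by the isomorphism `κ`, the cell is the carrier of the map from the free algebra to `G
(p_L a + i e)`, invertible by `isIso_freeEMDesc_inr`. -/
theorem isIso_carrierLift_delta (i : S.T.obj (⊥_ A) ≅ Monad.id S.Carrier) (a : A) (e : InitialFibre p.proj) :
    IsIso ((carrierLift G).delta a e) := by
  let G' : p.Total ⥤ EMObj S.T := G.toFunctor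
  have hG : G'.IsEquivalence := inferInstanceAs G.toFunctor.IsEquivalence
  have hb (x : p.Total) : IsIso (resBase G x) := isIso_resBase G x
  have hD := isIso_freeEMDesc_inr (p := p.proj) i G' (fun x => resBase G x) hb
    (hb := fun m => resBase_naturality G m) a e (base_fibreIncl G e)
  have hD' := (emCarrier S.T).map_isIso (freeEMDesc (P := G'.obj (sumObj p.proj a e))
    (sumBase p.proj a e ≫ resBase G _) (G'.map coprod.inr).carrier)
  have h := (carrierLift G).delta_kappa a e
  have hu : (carrierFunctor G).map (sumUnit p.proj a e) ≫ carrierKappa G _ =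
      (G'.map coprod.inr).carrier := by
    rw [carrierFunctor_map_kappa, sumUnit, Equiv.symm_apply_apply]
  have h' : (carrierLift G).delta a e ≫ (carrierLift G).κ _ =
      (emCarrier S.T).map (freeEMDesc (P := G'.obj (sumObj p.proj a e))
        (sumBase p.proj a e ≫ resBase G _) (G'.map coprod.inr).carrier) :=
    h.trans (congrArg (fun t => algExtend S.T (sumBase p.proj a e ≫ resBase G _) t
      (G'.obj (sumObj p.proj a e)).alg.a) hu)
  have h₂ : IsIso ((carrierLift G).delta a e ≫ (carrierLift G).κ (sumObj p.proj a e)) := by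
    rw [h']; exact hD'
  exact IsIso.of_isIso_comp_right _ ((carrierLift G).κ (sumObj p.proj a e))

/-- The comparison functor of a fibration equivalent to an Eilenberg–Moore fibration of a
parametrized monad with trivial `T_∅` is an equivalence. -/
theorem comparison_isEquivalence (G : FibFunctor p (emFib S)) [G.toFunctor.IsEquivalence]
    (i : S.T.obj (⊥_ A) ≅ Monad.id S.Carrier) : (comparison p.proj).IsEquivalence := by
  let R := emMapFunctor (carrierLift G).toHom
  let t := carrierLiftIso G
  let G' : p.Total ⥤ EMObj S.T := G.toFunctor
  have hG : G'.IsEquivalence := inferInstanceAs G.toFunctor.IsEquivalence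
  let s : comparison p.proj ⋙ R ≅ G' :=
    { hom := t.hom.nat
      inv := t.inv.nat
      hom_inv_id := congrArg FibTrans.nat t.hom_inv_id
      inv_hom_id := congrArg FibTrans.nat t.inv_hom_id }
  have h₁ : (carrierLift G).toHom.V.Faithful := carrierFunctor_faithful G
  have h₂ : (carrierLift G).toHom.V.Full := carrierFunctor_full G i
  have hf : R.Faithful := emMapFunctor_faithful _
  have hF : R.Full := emMapFunctor_full _ (isIso_carrierLift_delta G i)
  have hc : (comparison p.proj ⋙ R).IsEquivalence := Functor.isEquivalence_of_iso s.symm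
  -- Essential surjectivity of the composite passes to its last factor, so `R` is an equivalence and
  -- can be cancelled.
  have hR : R.EssSurj := ⟨fun Q => ⟨(comparison p.proj).obj ((comparison p.proj ⋙ R).objPreimage Q),
    ⟨(comparison p.proj ⋙ R).objObjPreimageIso Q⟩⟩⟩
  have hE : R.IsEquivalence := { }
  exact Functor.isEquivalence_of_comp_right (comparison p.proj) R

end Recognition

end FibMon

theorem mainTheorem1 (A : Type u) [Category.{v} A] [HasInitial A] :
    ∃ (L : TwoFunctorOn (fibToMonad (A := A) :
          PrunedFib.{v, max v v', u, max u v v' w} A →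
          PrunedParamMonad.{v, max v v', u, max u v v' w} A))
      (adj : Biadjunction L.toStrict.toPseudofunctor
        (emPrunedTwoFunctor.{v, max v v', u, max u v v' w} A).toPseudofunctor),
      -- on 1-cells, the left adjoint restricts a fibred functor to the initial fibres
      (∀ {p q : PrunedFib.{v, max v v', u, max u v v' w} A} (F : p ⟶ q),
        (L.map F).hom.V ⋙ fibreIncl q.fib.proj = fibreIncl p.fib.proj ⋙ F.hom.toFunctor) ∧
      -- the unit is the comparison functor
      (∀ p : PrunedFib.{v, max v v', u, max u v v' w} A,
        (adj.unit.app p).hom.toFunctor = comparison p.fib.proj) ∧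
      -- the comparison functor is a fibred functor over `A`
      (∀ p : PrunedFib.{v, max v v', u, max u v v' w} A,
        comparison p.fib.proj ⋙ emProj (fibParamMonad p.fib.proj) = p.fib.proj ∧
        ∀ {a b : A} (f : a ⟶ b) {x y : p.fib.Total} (φ : x ⟶ y), p.fib.proj.IsCartesian f φ →
          (emProj (fibParamMonad p.fib.proj)).IsCartesian f ((comparison p.fib.proj).map φ)) ∧
      -- the comparison functor is an equivalence exactly for the Eilenberg–Moore fibrations
      (∀ p : PrunedFib.{v, max v v', u, max u v v' w} A,
        (comparison p.fib.proj).IsEquivalence ↔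
          ∃ T : ParamMonad.{v, max v v', u, max u v v' w} A,
            Nonempty (T.T.obj (⊥_ A) ≅ Monad.id T.Carrier) ∧
            Nonempty (Bicategory.Equivalence p.fib (emFib T))) := by
  refine ⟨fibTwoFunctor A, fibMonadBiadjunction A, fun _ => rfl, fun _ => rfl,
    fun p => ⟨rfl, fun f _ _ φ h => comparison_isCartesian p.fib.proj f φ h⟩,
    fun p => ⟨fun h => ?_, ?_⟩⟩
  · have h' : (comparisonFib p.fib).toFunctor.IsEquivalence := h
    -- The witness is `T^p` itself, with the comparison functor as the fibred equivalence.
    exact ⟨initialFibreMonad p.fib.proj, (fibParamMonad_isPruned p.fib.proj).2,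
      nonempty_equivalence_of_isEquivalence (comparisonFib p.fib)⟩
  · rintro ⟨T, ⟨i⟩, ⟨e⟩⟩
    have h := isEquivalence_of_equivalence e
    exact comparison_isEquivalence (p := p.fib) (S := T) e.hom i
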